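/- **Setting.** For $L>0$ let $\mathcal T_L=[0,L]^3$ be the three-dimensional torus and let $H_L$ be the space of periodic, divergence-free, zero-mean fields $u\in L^2(\mathcal T_L;\mathbb R^3)$ with $|u|^2_{H_L}=L^{-3}\int_{\mathcal T_L}|u|^2dx$. Put $\Lambda_L^{(\infty)}=\frac{2\pi}{L}\mathbb Z^3\setminus\{0\}$, $\Lambda^{(n)}_L=\{k\in\Lambda_L^{(\infty)}:|k|\le 2\pi n/L\}$ and $\hat u(k)=L^{-3}\int_{\mathcal T_L}e^{ik\cdot x}u(x)\,dx$. Let $A_L=-\Delta$ be the Stokes operator on $H_L$, with domain $D(A_L)$ the fields of $H_L$ in $\mathbb H^2$. Let $\mathcal P_L$ be the set of Borel probability measures $\mu$ on $H_L$ such that $\mu(D(A_L))=1$, $\int\int_{\mathcal T_L}\|Du(x)\|^2dx\,d\mu(u)<\infty$, $u(\cdot-a)$ has the same law as $u$ under $\mu$ for every $a\in\mathcal T_L$, and $u(R\,\cdot)$ has the same law as $Ru(\cdot)$ under $\mu$ for every rotation $R$ preserving the set of coordinate axes. **Noise.** Fix complex $3\times3$ matrices $\sigma_k$, $k\in\Lambda_1^{(\infty)}$,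 with $k\cdot\sigma_k=0$, $\overline{\sigma_k}=\sigma_{-k}$, $|\sigma_{Rk}|=|\sigma_k|$ for every $R$ as above (with $|\cdot|$ the Hilbert–Schmidt norm), $\sum_k|\sigma_k|^2<\infty$ and $\sum_k|k|^2|\sigma_k|^2<\infty$. Let $(\beta_k)$ be complex three-dimensional Brownian motions with independent components, independent real and imaginary parts, and $E|\beta_k^j(t)|^2=t$, such that $\beta_{-k}=\overline{\beta_k}$ and the $\beta_k$ are otherwise independent. For $k\in\Lambda_L^{(\infty)}$ put $\sigma_k^L=\sigma_{Lk}$ and $\beta^L_k=\beta_{Lk}$. **Stationary Navier–Stokes measures.** For $\nu>0$ and $n\in\mathbb N$ let $H^{(n)}_L$ be the subspace of $H_L$ of fields with modes in $\Lambda^{(n)}_L$, let $\pi^{(n)}_L$ be the orthogonal projection of $H_L$ onto it, and consider the Galerkin equation in $H_L^{(n)}$ $$du+\big[\nu A_Lu+\pi_L^{(n)}\big((u\cdot\nabla)u\big)\big]dt=\sum_{k\in\Lambda_L^{(n)}}\sigma_k^L\,d\beta_k^L\,e^{-ik\cdot x}.$$ Let $\mathcal S^n(\nu,L)$ be the set of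 its invariant measures that belong to $\mathcal P_L$, and let $\mathcal P^G_{NS}(\nu,L)$ be the set of probability measures $\mu$ on $H_L$ for which there are $k_j\to\infty$ and $\mu_j\in\mathcal S^{k_j}(\nu,L)$ with $\mu_j\to\mu$ weakly on $H_L$. Let $\tilde{\mathcal P}^G_{NS}$ be the set of all triples $(\mu,\nu,L)$ with $\nu,L>0$ and $\mu\in\mathcal P^G_{NS}(\nu,L)$. **Conditions.** An *admissible region* is a set $D=\{(\nu,L):0<\nu<\nu_0,\ L>R_0(\nu)\}$, where $\nu_0>0$ and $R_0:(0,\nu_0]\to[1,\infty)$ is strictly decreasing with $R_0(\nu)\to\infty$ as $\nu\to0$. Let $e$ be a coordinate unit vector. A set $\mathcal M$ of triples $(\mu,\nu,L)$, with $\mu$ a probability measure on $H_L$, satisfies *Condition A* if there are an admissible region $D$ and constants $C>c>0$ such that $$c\le\int_{H_L}\|u(e)-u(0)\|^2\,d\mu(u)\le C\qquad\text{for all }(\mu,\nu,L)\in\mathcal M\text{ with }(\nu,L)\in D;$$ here $u(x)$ is the limit of the averages of $u$ over the cubes $\{y:\max_j|y_j-x_j|<1/(n+1)\}$ as $n\to\infty$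 ($0$ if there is no limit), which is the value at $x$ of the continuous representative of $u$ if there is one. It satisfies *Condition B* if there are an admissible region $D$ and constants $C>c>0$ such that $$c\le\sum_{k\in\Lambda_L^{(\infty)},\,\|k\|\le1}\|k\|^2\int_{H_L}\|\hat u(k)\|^2d\mu(u)+\sum_{k\in\Lambda_L^{(\infty)},\,\|k\|>1}\int_{H_L}\|\hat u(k)\|^2d\mu(u)\le C$$ for all $(\mu,\nu,L)\in\mathcal M$ with $(\nu,L)\in D$. **Theorem (Condition A implies Condition B).** If $\tilde{\mathcal P}^G_{NS}$ satisfies Condition A (for one coordinate unit vector $e$), then it satisfies Condition B (the admissible regions and constants in the two conditions need not be the same). -/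

import Mathlib

open MeasureTheory ProbabilityTheory Filter Topology BoundedContinuousFunction
open scoped NNReal ENNReal

namespace NSK41

noncomputable section

/-! ### The torus `𝒯_L = [0,L]³` and vector fields on it -/

/-- The three-dimensional torus of side `L`. -/
abbrev Torus (L : ℝ) : Type := Fin 3 → AddCircle L

/-- Velocities, with the Euclidean norm. -/
abbrev Vec : Type := EuclideanSpace ℝ (Fin 3)

/-- The normalised Lebesgue measure `L⁻³ dx` on the torus. -/
def torusMeasure (L : ℝ) [Fact (0 < L)] : Measure (Torus L) :=
  Measure.pi fun _ => AddCircle.haarAddCircle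

instance (L : ℝ) [Fact (0 < L)] : IsProbabilityMeasure (torusMeasure L) := by
  unfold torusMeasure; infer_instance

instance (L : ℝ) [Fact (0 < L)] : (torusMeasure L).IsAddHaarMeasure := by
  unfold torusMeasure; infer_instance

/-- `𝕃²(𝒯_L)`, with the inner product `L⁻³ ∫ u · v dx`. -/
abbrev L2 (L : ℝ) [Fact (0 < L)] : Type := Lp Vec 2 (torusMeasure L)

/-- The partial derivative `∂f/∂x_j` of a function on the torus. -/
def pderiv {L : ℝ} (j : Fin 3) (f : Torus L → ℝ) (x : Torus L) : ℝ :=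
  deriv (fun t : ℝ => f (x + Pi.single j (t : AddCircle L))) 0

/-- `C^∞` functions on the torus: those whose periodic lift to `ℝ³` is `C^∞`. -/
def IsSmooth {L : ℝ} (f : Torus L → ℝ) : Prop :=
  ContDiff ℝ ((⊤ : ℕ∞) : WithTop ℕ∞) fun y : Fin 3 → ℝ => f fun j => (y j : AddCircle L)

/-- `div u = 0` on the torus, in the sense of distributions. -/
def IsDivFree {L : ℝ} [Fact (0 < L)] (u : L2 L) : Prop :=
  ∀ φ : Torus L → ℝ, IsSmooth φ → ∫ x, ∑ j, u x j * pderiv j φ x ∂torusMeasure L = 0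

/-- The space `H_L` of periodic, divergence-free, zero-mean fields in `𝕃²(𝒯_L)`. -/
abbrev H (L : ℝ) [Fact (0 < L)] : Type :=
  {u : L2 L // IsDivFree u ∧ ∫ x, u x ∂torusMeasure L = 0}

instance (L : ℝ) [Fact (0 < L)] : MeasurableSpace (H L) := borel (H L)

instance (L : ℝ) [Fact (0 < L)] : BorelSpace (H L) := ⟨rfl⟩

/-! ### Fourier analysis.  The wave vector `k = (2π/L) m` is indexed by `m ∈ ℤ³`. -/

/-- The wave vector `k = (2π/L) m`. -/
def wave (L : ℝ) (m : Fin 3 → ℤ) : Vec := WithLp.toLp 2 fun j => 2 * Real.pi / L * (m j : ℝ)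

/-- The character `x ↦ e^{i k·x}` with `k = (2π/L) m`. -/
def character {L : ℝ} (m : Fin 3 → ℤ) (x : Torus L) : ℂ := ∏ j, fourier (m j) (x j)

/-- `û(k) = L⁻³ ∫ e^{i k·x} u(x) dx`, so that `u(x) = ∑ₖ e^{-i k·x} û(k)`. -/
def fourierCoef {L : ℝ} [Fact (0 < L)] (u : L2 L) (m : Fin 3 → ℤ) : EuclideanSpace ℂ (Fin 3) :=
  WithLp.toLp 2 fun j => ∫ x, character m x * (u x j : ℂ) ∂torusMeasure L

/-- `L⁻³ ∫ ‖Du‖² dx = ∑ₖ |k|² ‖û(k)‖²`, finite if and only if `u` is in `ℍ¹`. -/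
def dirichletEnergy {L : ℝ} [Fact (0 < L)] (u : L2 L) : ℝ≥0∞ :=
  ∑' m : Fin 3 → ℤ, ‖wave L m‖ₑ ^ 2 * ‖fourierCoef u m‖ₑ ^ 2

/-- The domain `D(A_L) = H_L ∩ ℍ²` of the Stokes operator. -/
def stokesDomain (L : ℝ) [Fact (0 < L)] : Set (H L) :=
  {u | ∑' m : Fin 3 → ℤ, ‖wave L m‖ₑ ^ 4 * ‖fourierCoef u.1 m‖ₑ ^ 2 < ∞}

/-! ### Translations and coordinate rotations; the class `𝒫_L` -/

theorem measurePreserving_sub (L : ℝ) [Fact (0 < L)] (a : Torus L) :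
    MeasurePreserving (fun x => x - a) (torusMeasure L) (torusMeasure L) :=
  measurePreserving_sub_right _ a

/-- `u ↦ u(· - a)`. -/
def translate {L : ℝ} [Fact (0 < L)] (a : Torus L) (u : L2 L) : L2 L :=
  Lp.compMeasurePreserving (fun x => x - a) (measurePreserving_sub L a) u

/-- Rotations mapping the set of coordinate axes to itself: integer rotation matrices. -/
abbrev CoordRotation : Type := Matrix.specialOrthogonalGroup (Fin 3) ℤ

/-- The action `x ↦ R x` of a coordinate rotation on the torus. -/
def torusRotation (L : ℝ) (R : CoordRotation) : Torus L →+ Torus L where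
  toFun x j := ∑ l, R.1 j l • x l
  map_zero' := by ext j; simp
  map_add' x y := by ext j; simp [Finset.sum_add_distrib]

theorem measurePreserving_torusRotation (L : ℝ) [Fact (0 < L)] (R : CoordRotation) :
    MeasurePreserving (torusRotation L R) (torusMeasure L) (torusMeasure L) := by
  refine AddMonoidHom.measurePreserving ?_ ?_ rfl
  · refine continuous_pi fun j => ?_
    exact continuous_finsetSum Finset.univ fun l _ => (continuous_apply l).zsmul (R.1 j l)
  · have h : ∀ (S T : CoordRotation) (x : Torus L),
        torusRotation L (S * T) x = torusRotation L S (torusRotation L T x) := by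
      intro S T x
      ext j
      simp only [torusRotation, AddMonoidHom.coe_mk, ZeroHom.coe_mk, Finset.smul_sum]
      rw [Finset.sum_comm]
      refine Finset.sum_congr rfl fun l _ => ?_
      simp [Matrix.mul_apply, Finset.sum_smul, mul_smul]
    have h1 : ∀ x : Torus L, torusRotation L 1 x = x := by
      intro x
      ext j
      simp [torusRotation, Matrix.one_apply, ite_smul]
    intro y
    exact ⟨torusRotation L R⁻¹ y, by rw [← h, mul_inv_cancel, h1]⟩

/-- `u ↦ u(R ·)`. -/
def rotateArgument {L : ℝ} [Fact (0 < L)] (R : CoordRotation) (u : L2 L) : L2 L :=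
  Lp.compMeasurePreserving (torusRotation L R) (measurePreserving_torusRotation L R) u

/-- `u ↦ R u(·)`. -/
def rotateValue {L : ℝ} [Fact (0 < L)] (R : CoordRotation) (u : L2 L) : L2 L :=
  (Matrix.toEuclideanCLM (n := Fin 3) (𝕜 := ℝ) (R.1.map (Int.cast : ℤ → ℝ))).compLp u

/-- The class `𝒫_L`: probability measures on `H_L`, concentrated on `D(A_L)`, with finite mean
of `∫ ‖Du‖²`, space homogeneous and partially (discretely) isotropic. -/
structure InClassP (L : ℝ) [Fact (0 < L)] (μ : ProbabilityMeasure (H L)) : Prop where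
  domain : ∀ᵐ u ∂(μ : Measure (H L)), u ∈ stokesDomain L
  finite_enstrophy : ∫⁻ u, dirichletEnergy u.1 ∂(μ : Measure (H L)) < ∞
  homogeneous : ∀ (a : Torus L) (f : L2 L →ᵇ ℝ),
    ∫ u, f (translate a u.1) ∂(μ : Measure (H L)) = ∫ u, f u.1 ∂(μ : Measure (H L))
  isotropic : ∀ (R : CoordRotation) (f : L2 L →ᵇ ℝ),
    ∫ u, f (rotateArgument R u.1) ∂(μ : Measure (H L)) =
      ∫ u, f (rotateValue R u.1) ∂(μ : Measure (H L))

/-! ### The noise -/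

/-- `|M|² = ∑ᵢⱼ |Mᵢⱼ|²`. -/
def matrixNormSq (M : Matrix (Fin 3) (Fin 3) ℂ) : ℝ := ∑ i, ∑ j, ‖M i j‖ ^ 2

/-- The covariance coefficients `σ_k` of the noise on the unit torus, `k = 2πm` with
`m ∈ ℤ³ ∖ {0}`.  On the torus of side `L` the coefficient of `k = (2π/L) m` is `σ_{Lk}`,
that is, again the one with index `m`.  The value at `m = 0` is never used. -/
structure NoiseCoefficients where
  σ : (Fin 3 → ℤ) → Matrix (Fin 3) (Fin 3) ℂ
  divFree : ∀ m, m ≠ 0 → Matrix.vecMul (fun j => (wave 1 m j : ℂ)) (σ m) = 0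
  summable : Summable fun m : {m : Fin 3 → ℤ // m ≠ 0} => matrixNormSq (σ m)
  real : ∀ m, m ≠ 0 → (σ m).map (starRingEnd ℂ) = σ (-m)
  isotropic : ∀ m, m ≠ 0 → ∀ R : CoordRotation,
    matrixNormSq (σ (R.1.mulVec m)) = matrixNormSq (σ m)
  summable_sq : Summable fun m : {m : Fin 3 → ℤ // m ≠ 0} => ‖wave 1 m‖ ^ 2 * matrixNormSq (σ m)

/-- One half of `ℤ³ ∖ {0}`, containing exactly one of `m`, `-m` for every `m ≠ 0`. -/
abbrev HalfLattice : Type := {m : Fin 3 → ℤ // (0 : Lex (Fin 3 → ℤ)) < toLex m}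

/-- The driving processes: `β_m` is a complex three-dimensional Brownian motion with
`E|β_m^j(t)|² = t`, `β_{-m}` is its complex conjugate (this makes the noise real and space
homogeneous), and they are otherwise independent: the processes `√2 Re β_m^j`, `√2 Im β_m^j`,
with `m` in the half lattice, are independent standard Brownian motions. -/
structure IsDrivingNoise {Ω : Type} [MeasurableSpace Ω] (P : Measure Ω)
    (β : (Fin 3 → ℤ) → Fin 3 → ℝ≥0 → Ω → ℂ) : Prop where
  measurable : ∀ m j t, Measurable (β m j t)
  conj : ∀ m j t ω, β (-m) j t ω = starRingEnd ℂ (β m j t ω)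
  brownian_re : ∀ (m : HalfLattice) (j : Fin 3),
    IsBrownianReal (fun t ω => √2 * (β m j t ω).re) P
  brownian_im : ∀ (m : HalfLattice) (j : Fin 3),
    IsBrownianReal (fun t ω => √2 * (β m j t ω).im) P
  indep : iIndepFun (fun (q : HalfLattice × Fin 3 × Bool) (ω : Ω) (t : ℝ≥0) =>
    if q.2.2 then (β q.1 q.2.1 t ω).re else (β q.1 q.2.1 t ω).im) P

/-! ### Galerkin approximations of the stochastic Navier–Stokes equations -/

/-- The modes `0 < |k| ≤ 2πn/L`, that is, `0 < |m| ≤ n`. -/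
def modes (n : ℕ) : Finset (Fin 3 → ℤ) :=
  (Fintype.piFinset fun _ => Finset.Icc (-(n : ℤ)) n).filter
    fun m => m ≠ 0 ∧ ∑ j, m j ^ 2 ≤ (n : ℤ) ^ 2

/-- The subspace `H_L^{(n)}` of fields whose only modes are those of index `n`. -/
def galerkinSpace (L : ℝ) [Fact (0 < L)] (n : ℕ) : Set (H L) :=
  {u | ∀ m, m ∉ modes n → fourierCoef u.1 m = 0}

/-- The trigonometric polynomial `∑ e^{-i k·x} û(k)` over the modes of index `n`; for `u` in
`H_L^{(n)}` this is the smooth representative of `u`. -/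
def trigPoly {L : ℝ} [Fact (0 < L)] (n : ℕ) (u : L2 L) (x : Torus L) : Vec :=
  WithLp.toLp 2 fun j => (∑ m ∈ modes n, character (-m) x * fourierCoef u m j).re

/-- `Δ u`. -/
def laplace {L : ℝ} (u : Torus L → Vec) (x : Torus L) : Vec :=
  WithLp.toLp 2 fun j => ∑ i, pderiv i (pderiv i fun y => u y j) x

/-- `(u · ∇) v`. -/
def advect {L : ℝ} (u v : Torus L → Vec) (x : Torus L) : Vec :=
  WithLp.toLp 2 fun j => ∑ i, u x i * pderiv i (fun y => v y j) x

/-- `∑ σ_k b_k e^{-i k·x}` over the modes of index `n`. -/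
def noiseField {L : ℝ} (σ : NoiseCoefficients) (n : ℕ) (b : (Fin 3 → ℤ) → Fin 3 → ℂ)
    (x : Torus L) : Vec :=
  WithLp.toLp 2 fun j => (∑ m ∈ modes n, character (-m) x * (σ.σ m).mulVec (b m) j).re

/-- `v` solves, along the noise path `b`, the Galerkin equation in `H_L^{(n)}`
`dv + [ν A v + π B(v,v)] dt = ∑ σ_k db_k e^{-i k·x}`,
written in integrated form and tested against the elements of `H_L^{(n)}`. -/
structure IsGalerkinPath (σ : NoiseCoefficients) (ν L : ℝ) [Fact (0 < L)] (n : ℕ)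
    (b : (Fin 3 → ℤ) → Fin 3 → ℝ≥0 → ℂ) (v : ℝ≥0 → H L) : Prop where
  continuous : Continuous v
  mem : ∀ t, v t ∈ galerkinSpace L n
  equation : ∀ w ∈ galerkinSpace L n, ∀ t : ℝ≥0,
    inner ℝ (v t).1 w.1 = inner ℝ (v 0).1 w.1
      + (∫ s in (0 : ℝ)..t, ∫ x, inner ℝ
          (ν • laplace (trigPoly n (v s.toNNReal).1) x
            - advect (trigPoly n (v s.toNNReal).1) (trigPoly n (v s.toNNReal).1) x)
          (w.1 x) ∂torusMeasure L)
      + ∫ x, inner ℝ (noiseField σ n (fun m j => b m j t) x) (w.1 x) ∂torusMeasure L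

/-- `μ` is an invariant measure of the Galerkin equation: the solution issued from an initial
datum with law `μ`, independent of the noise, has law `μ` at all times. -/
def IsGalerkinInvariant (σ : NoiseCoefficients) (ν L : ℝ) [Fact (0 < L)] (n : ℕ)
    (μ : ProbabilityMeasure (H L)) : Prop :=
  ∃ (Ω : Type) (_ : MeasurableSpace Ω) (P : Measure Ω) (_ : IsProbabilityMeasure P)
    (β : (Fin 3 → ℤ) → Fin 3 → ℝ≥0 → Ω → ℂ) (u : ℝ≥0 → Ω → H L),
    IsDrivingNoise P β ∧ (∀ t, Measurable (u t)) ∧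
    IndepFun (u 0) (fun ω (m : Fin 3 → ℤ) (j : Fin 3) (t : ℝ≥0) => β m j t ω) P ∧
    (∀ᵐ ω ∂P, IsGalerkinPath σ ν L n (fun m j t => β m j t ω) fun t => u t ω) ∧
    ∀ t, P.map (u t) = μ

/-- The set `𝒮ⁿ` of homogeneous, isotropic invariant measures of the Galerkin equation. -/
def galerkinStationary (σ : NoiseCoefficients) (ν L : ℝ) [Fact (0 < L)] (n : ℕ) :
    Set (ProbabilityMeasure (H L)) :=
  {μ | InClassP L μ ∧ IsGalerkinInvariant σ ν L n μ}

/-- The set `𝒫_NS^G(ν, L)` of limit points, in the weak topology, of `𝒮ⁿ` as `n → ∞`. -/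
def stationaryNS (σ : NoiseCoefficients) (ν L : ℝ) [Fact (0 < L)] :
    Set (ProbabilityMeasure (H L)) :=
  {μ | ∃ (k : ℕ → ℕ) (μs : ℕ → ProbabilityMeasure (H L)), Tendsto k atTop atTop ∧
    (∀ i, μs i ∈ galerkinStationary σ ν L (k i)) ∧ Tendsto μs atTop (𝓝 μ)}

/-- Triples `(μ, ν, L)` with `ν, L > 0` and `μ` a probability measure on `H_L`. -/
structure Triple where
  ν : ℝ
  ν_pos : 0 < ν
  L : ℝ
  [L_pos : Fact (0 < L)]
  μ : ProbabilityMeasure (H L)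

attribute [instance] Triple.L_pos

/-- The rescaled family: all triples `(μ, ν, L)` with `μ ∈ 𝒫_NS^G(ν, L)`. -/
def rescaledNS (σ : NoiseCoefficients) : Set Triple :=
  {τ | τ.μ ∈ stationaryNS σ τ.ν τ.L}

/-! ### Conditions A and B -/

open Classical in
/-- The value `u(x)`: the limit of the averages of `u` over balls shrinking to `x` (and `0` where
there is no limit).  If `u` has a continuous representative, this is its value at `x`. -/
def pointValue {L : ℝ} [Fact (0 < L)] (u : L2 L) (x : Torus L) : Vec :=
  if h : ∃ a, Tendsto (fun n : ℕ => ⨍ y in Metric.ball x (1 / ((n : ℝ) + 1)), u y ∂torusMeasure L)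
    atTop (𝓝 a) then h.choose else 0

/-- `μ[‖u(e) - u(0)‖²]`, where `e` is the `i`-th coordinate unit vector. -/
def meanSquareIncrement (i : Fin 3) (τ : Triple) : ℝ≥0∞ :=
  ∫⁻ u, ‖pointValue u.1 (Pi.single i ((1 : ℝ) : AddCircle τ.L)) - pointValue u.1 0‖ₑ ^ 2
    ∂(τ.μ : Measure (H τ.L))

/-- `μ[‖û(k)‖²]`, with `k = (2π/L) m`. -/
def modeEnergy (τ : Triple) (m : Fin 3 → ℤ) : ℝ≥0∞ :=
  ∫⁻ u, ‖fourierCoef u.1 m‖ₑ ^ 2 ∂(τ.μ : Measure (H τ.L))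

/-- Enstrophy of the low modes `|k| ≤ 1` plus energy of the high modes `|k| > 1`. -/
def lowHighSum (τ : Triple) : ℝ≥0∞ :=
  (∑' m : {m : Fin 3 → ℤ // m ≠ 0 ∧ ‖wave τ.L m‖ ≤ 1}, ‖wave τ.L m‖ₑ ^ 2 * modeEnergy τ m) +
    ∑' m : {m : Fin 3 → ℤ // m ≠ 0 ∧ 1 < ‖wave τ.L m‖}, modeEnergy τ m

/-- Admissible regions `{(ν, L) : 0 < ν < ν₀, L > R₀(ν)}`, where `R₀ : (0, ν₀] → [1, ∞)` is
strictly decreasing and tends to `∞` at `0`. -/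
def IsAdmissible (D : Set (ℝ × ℝ)) : Prop :=
  ∃ (ν₀ : ℝ) (R₀ : ℝ → ℝ), 0 < ν₀ ∧ (∀ ν ∈ Set.Ioc 0 ν₀, 1 ≤ R₀ ν) ∧
    StrictAntiOn R₀ (Set.Ioc 0 ν₀) ∧ Tendsto R₀ (𝓝[>] 0) atTop ∧
    D = {p | 0 < p.1 ∧ p.1 < ν₀ ∧ R₀ p.1 < p.2}

/-- Condition A, with the `i`-th coordinate unit vector as `e`. -/
def ConditionA (i : Fin 3) (M : Set Triple) : Prop :=
  ∃ D, IsAdmissible D ∧ ∃ c C : ℝ, 0 < c ∧ c < C ∧ ∀ τ ∈ M, (τ.ν, τ.L) ∈ D →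
    ENNReal.ofReal c ≤ meanSquareIncrement i τ ∧ meanSquareIncrement i τ ≤ ENNReal.ofReal C

/-- Condition B. -/
def ConditionB (M : Set Triple) : Prop :=
  ∃ D, IsAdmissible D ∧ ∃ c C : ℝ, 0 < c ∧ c < C ∧ ∀ τ ∈ M, (τ.ν, τ.L) ∈ D →
    ENNReal.ofReal c ≤ lowHighSum τ ∧ lowHighSum τ ≤ ENNReal.ofReal C

end

end NSK41

/-!
For a homogeneous isotropic law `μ`, Parseval's identity gives
`μ[‖u(t e) - u(0)‖²] = ∑ₖ (2 - 2 cos (t k · e)) μ[‖û(k)‖²]` for every coordinate unit vector `e`.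
The weight at `t = 1` is at most `4 min (‖k‖², 1)`, which gives the lower bound in Condition B. It
is not bounded below by `min (‖k‖², 1)`, because it vanishes at the multiples of `2π`, but its
average over `t ∈ [1/8, 1]` and over the three coordinate directions is, up to a constant.

The increments at distance `t = l³ ≤ 1` are controlled by scaling: if `u` has a law in
`𝒫_NS^G(ν, L)`, then `l⁻¹ u(l³ ·)` has a law in `𝒫_NS^G(ν l⁻⁴, L l⁻³)`, and its increment at
distance `1` is `l⁻¹` times the increment of `u` at distance `l³`. For `l ∈ [1/2, 1]` the new
parameters stay in the region of Condition A as soon as `ν` is smaller than `ν₀ / 16`.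
-/

namespace NSK41

noncomputable section

/-! ### Dilations of the torus -/

/-- The dilation `x ↦ (L' / L) x` from the torus of side `L` to the torus of side `L'`, as an
isomorphism of topological groups. -/
def dilation (L L' : ℝ) [hL : Fact (0 < L)] [hL' : Fact (0 < L')] : Torus L ≃ₜ+ Torus L' where
  toAddEquiv := AddEquiv.piCongrRight fun _ =>
    AddCircle.equivAddCircle L L' hL.out.ne' hL'.out.ne'
  continuous_toFun := continuous_pi fun j =>
    (AddCircle.homeomorphAddCircle L L' hL.out.ne' hL'.out.ne').continuous.comp
      (continuous_apply j)
  continuous_invFun := continuous_pi fun j =>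
    (AddCircle.homeomorphAddCircle L L' hL.out.ne' hL'.out.ne').symm.continuous.comp
      (continuous_apply j)

theorem exists_coe_torus {L : ℝ} (x : Torus L) :
    ∃ y : Fin 3 → ℝ, (fun j => (y j : AddCircle L)) = x :=
  (Function.Surjective.piMap fun _ => QuotientAddGroup.mk_surjective) x

theorem wave_eq_smul {L : ℝ} (hL : L ≠ 0) (L' : ℝ) (m : Fin 3 → ℤ) :
    wave L' m = (L'⁻¹ * L) • wave L m := by
  ext j
  simp only [wave, PiLp.smul_apply, smul_eq_mul]
  field_simp

section Dilation

variable {L L' : ℝ} [Fact (0 < L)] [Fact (0 < L')]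

theorem dilation_apply (x : Torus L) (j : Fin 3) :
    dilation L L' x j =
      AddCircle.equivAddCircle L L' (Fact.out : 0 < L).ne' (Fact.out : 0 < L').ne' (x j) :=
  rfl

theorem dilation_apply_coe (y : Fin 3 → ℝ) :
    dilation L L' (fun j => (y j : AddCircle L)) =
      fun j => ((L⁻¹ * L' * y j : ℝ) : AddCircle L') := by
  ext j
  rw [dilation_apply, AddCircle.equivAddCircle_apply_mk, mul_comm]

theorem dilation_dilation (x : Torus L) : dilation L' L (dilation L L' x) = x := by
  obtain ⟨y, rfl⟩ := exists_coe_torus x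
  have h : L ≠ 0 := (Fact.out : 0 < L).ne'
  have h' : L' ≠ 0 := (Fact.out : 0 < L').ne'
  simp only [dilation_apply_coe]
  field_simp

theorem dilation_single (j : Fin 3) (t : ℝ) :
    dilation L L' (Pi.single j (t : AddCircle L)) =
      Pi.single j ((L⁻¹ * L' * t : ℝ) : AddCircle L') := by
  ext i
  rw [dilation_apply]
  rcases eq_or_ne i j with rfl | h
  · rw [Pi.single_eq_same, Pi.single_eq_same, AddCircle.equivAddCircle_apply_mk, mul_comm]
  · rw [Pi.single_eq_of_ne h, Pi.single_eq_of_ne h, map_zero]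

theorem measurePreserving_dilation (L L' : ℝ) [Fact (0 < L)] [Fact (0 < L')] :
    MeasurePreserving (dilation L L') (torusMeasure L) (torusMeasure L') :=
  AddMonoidHom.measurePreserving (f := (dilation L L' : Torus L →+ Torus L'))
    (dilation L L').continuous (dilation L L').surjective (by simp)

theorem integral_dilation {E : Type*} [NormedAddCommGroup E] [NormedSpace ℝ E] (g : Torus L' → E) :
    ∫ x, g (dilation L L' x) ∂torusMeasure L = ∫ y, g y ∂torusMeasure L' :=
  (measurePreserving_dilation L L').integral_comp
    (dilation L L').toHomeomorph.measurableEmbedding g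

theorem character_dilation (m : Fin 3 → ℤ) (x : Torus L) :
    character m (dilation L L' x) = character m x := by
  obtain ⟨y, rfl⟩ := exists_coe_torus x
  have h' : (L' : ℂ) ≠ 0 := Complex.ofReal_ne_zero.2 (Fact.out : 0 < L').ne'
  rw [dilation_apply_coe]
  refine Finset.prod_congr rfl fun j _ => ?_
  rw [fourier_coe_apply, fourier_coe_apply]
  push_cast
  field_simp

theorem torusRotation_dilation (R : CoordRotation) (x : Torus L) :
    torusRotation L' R (dilation L L' x) = dilation L L' (torusRotation L R x) := by
  ext j
  simp [torusRotation, dilation_apply, map_sum, map_zsmul]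

end Dilation

/-! ### Dilations of square integrable fields -/

theorem Lp_compMeasurePreserving_congr {α β E : Type*} [MeasurableSpace α] [MeasurableSpace β]
    [NormedAddCommGroup E] {μ : Measure α} {ν : Measure β} {p : ℝ≥0∞} {f g : α → β}
    (hf : MeasurePreserving f μ ν) (hg : MeasurePreserving g μ ν) (h : f = g) (u : Lp E p ν) :
    Lp.compMeasurePreserving f hf u = Lp.compMeasurePreserving g hg u := by
  subst h
  rfl

/-- `u ↦ u((L / L') ·)`, from fields on the torus of side `L` to fields on that of side `L'`. -/
def dilate (L L' : ℝ) [Fact (0 < L)] [Fact (0 < L')] : L2 L →ₗᵢ[ℝ] L2 L' :=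
  Lp.compMeasurePreservingₗᵢ ℝ (dilation L' L) (measurePreserving_dilation L' L)

section Dilate

variable {L L' : ℝ} [Fact (0 < L)] [Fact (0 < L')]

theorem dilate_apply (u : L2 L) :
    dilate L L' u = Lp.compMeasurePreserving (dilation L' L) (measurePreserving_dilation L' L) u :=
  rfl

theorem coeFn_dilate (u : L2 L) :
    dilate L L' u =ᵐ[torusMeasure L'] fun x => u (dilation L' L x) :=
  Lp.coeFn_compMeasurePreserving u (measurePreserving_dilation L' L)

theorem dilate_dilate (u : L2 L) : dilate L' L (dilate L L' u) = u := by
  rw [dilate_apply, dilate_apply, ← Lp.compMeasurePreserving_comp_apply]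
  exact (Lp_compMeasurePreserving_congr _ (.id _) (funext dilation_dilation) u).trans
    (Lp.compMeasurePreserving_id_apply u)

theorem inner_dilate (u : L2 L) (w : L2 L') :
    inner ℝ (dilate L L' u) w = inner ℝ u (dilate L' L w) := by
  rw [← (dilate L L').inner_map_map u, dilate_dilate]

theorem translate_dilate (a : Torus L') (u : L2 L) :
    translate a (dilate L L' u) = dilate L L' (translate (dilation L' L a) u) := by
  rw [dilate_apply, dilate_apply, translate, translate, ← Lp.compMeasurePreserving_comp_apply,
    ← Lp.compMeasurePreserving_comp_apply]
  exact Lp_compMeasurePreserving_congr _ _ (funext fun x => map_sub _ x a) u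

theorem rotateArgument_dilate (R : CoordRotation) (u : L2 L) :
    rotateArgument R (dilate L L' u) = dilate L L' (rotateArgument R u) := by
  rw [dilate_apply, dilate_apply, rotateArgument, rotateArgument,
    ← Lp.compMeasurePreserving_comp_apply, ← Lp.compMeasurePreserving_comp_apply]
  exact Lp_compMeasurePreserving_congr _ _ (funext fun x => (torusRotation_dilation R x).symm) u

theorem coeFn_rotateValue (R : CoordRotation) (u : L2 L) :
    rotateValue R u =ᵐ[torusMeasure L] fun x =>
      Matrix.toEuclideanCLM (n := Fin 3) (𝕜 := ℝ) (R.1.map (Int.cast : ℤ → ℝ)) (u x) :=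
  ContinuousLinearMap.coeFn_compLp _ u

theorem rotateValue_dilate (R : CoordRotation) (u : L2 L) :
    rotateValue R (dilate L L' u) = dilate L L' (rotateValue R u) := by
  refine Lp.ext ?_
  have hcomp := (measurePreserving_dilation L' L).quasiMeasurePreserving.ae_eq_comp
    (coeFn_rotateValue R u)
  filter_upwards [coeFn_dilate (L' := L') u, hcomp, coeFn_rotateValue R (dilate L L' u),
    coeFn_dilate (L' := L') (rotateValue R u)] with x hu hcomp hleft hright
  rw [hleft, hright, hu]
  exact hcomp.symm

theorem translate_smul (a : Torus L) (c : ℝ) (u : L2 L) : translate a (c • u) = c • translate a u :=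
  (Lp.compMeasurePreservingₗ ℝ _ (measurePreserving_sub L a)).map_smul c u

theorem rotateArgument_smul (R : CoordRotation) (c : ℝ) (u : L2 L) :
    rotateArgument R (c • u) = c • rotateArgument R u :=
  (Lp.compMeasurePreservingₗ ℝ _ (measurePreserving_torusRotation L R)).map_smul c u

theorem rotateValue_smul (R : CoordRotation) (c : ℝ) (u : L2 L) :
    rotateValue R (c • u) = c • rotateValue R u :=
  ((Matrix.toEuclideanCLM (n := Fin 3) (𝕜 := ℝ)
    (R.1.map (Int.cast : ℤ → ℝ))).compLpₗ 2 (torusMeasure L)).map_smul c u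

theorem integral_dilate (u : L2 L) :
    ∫ x, dilate L L' u x ∂torusMeasure L' = ∫ x, u x ∂torusMeasure L := by
  rw [integral_congr_ae (coeFn_dilate u), integral_dilation]

theorem integral_inner_dilation (g : Torus L → Vec) (w : L2 L') :
    ∫ x, inner ℝ (g (dilation L' L x)) (w x) ∂torusMeasure L' =
      ∫ y, inner ℝ (g y) (dilate L' L w y) ∂torusMeasure L := by
  rw [← integral_dilation (L := L') (L' := L)]
  refine integral_congr_ae ?_
  have hw := coeFn_dilate (L' := L') (dilate L' L w)
  rw [dilate_dilate] at hw
  filter_upwards [hw] with x hx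
  rw [hx]

theorem integral_inner_smul_dilation (c : ℝ) (g : Torus L → Vec) (w : L2 L') :
    ∫ x, inner ℝ (c • g (dilation L' L x)) (w x) ∂torusMeasure L' =
      c * ∫ y, inner ℝ (g y) (dilate L' L w y) ∂torusMeasure L := by
  simp only [real_inner_smul_left, integral_const_mul, integral_inner_dilation]

theorem fourierCoef_dilate (u : L2 L) (m : Fin 3 → ℤ) :
    fourierCoef (dilate L L' u) m = fourierCoef u m := by
  ext j
  simp only [fourierCoef]
  rw [← integral_dilation (L := L') (L' := L)]
  refine integral_congr_ae ?_
  filter_upwards [coeFn_dilate (L' := L') u] with x hx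
  rw [hx, character_dilation]

theorem fourierCoef_smul (c : ℝ) (u : L2 L) (m : Fin 3 → ℤ) :
    fourierCoef (c • u) m = (c : ℂ) • fourierCoef u m := by
  ext j
  simp only [fourierCoef, PiLp.smul_apply, smul_eq_mul]
  rw [← integral_const_mul]
  refine integral_congr_ae ?_
  filter_upwards [Lp.coeFn_smul c u] with x hx
  rw [hx, Pi.smul_apply, PiLp.smul_apply, smul_eq_mul, Complex.ofReal_mul, mul_left_comm]

end Dilate

/-! ### Rescaling of solenoidal fields -/

theorem pderiv_const_mul {L : ℝ} (j : Fin 3) (c : ℝ) (f : Torus L → ℝ) (x : Torus L) :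
    pderiv j (fun y => c * f y) x = c * pderiv j f x :=
  deriv_const_mul_field c

section Rescale

variable {L L' : ℝ} [Fact (0 < L)] [Fact (0 < L')]

theorem pderiv_comp_dilation (j : Fin 3) (f : Torus L → ℝ) (x : Torus L') :
    pderiv j (fun y => f (dilation L' L y)) x = L'⁻¹ * L * pderiv j f (dilation L' L x) := by
  simp only [pderiv, map_add, dilation_single]
  simpa only [mul_zero, smul_eq_mul] using deriv_comp_mul_left (L'⁻¹ * L)
    (fun t : ℝ => f (dilation L' L x + Pi.single j (t : AddCircle L))) 0

theorem IsSmooth.comp_dilation {f : Torus L → ℝ} (hf : IsSmooth f) :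
    IsSmooth fun x => f (dilation L' L x) := by
  unfold IsSmooth at hf ⊢
  simp only [dilation_apply_coe]
  have hlin : ContDiff ℝ ((⊤ : ℕ∞) : WithTop ℕ∞) fun (y : Fin 3 → ℝ) j => L'⁻¹ * L * y j := by
    fun_prop
  exact hf.comp hlin

theorem IsDivFree.dilate {u : L2 L} (hu : IsDivFree u) : IsDivFree (dilate L L' u) := by
  intro φ hφ
  let ψ (y : Torus L) : ℝ := φ (dilation L L' y)
  let flux (y : Torus L) : ℝ := ∑ j, u y j * pderiv j ψ y
  have hderiv (x : Torus L') (j : Fin 3) :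
      pderiv j φ x = L'⁻¹ * L * pderiv j ψ (dilation L' L x) := by
    simp only [ψ, ← pderiv_comp_dilation, dilation_dilation]
  calc ∫ x, ∑ j, NSK41.dilate L L' u x j * pderiv j φ x ∂torusMeasure L'
      = ∫ x, L'⁻¹ * L * flux (dilation L' L x) ∂torusMeasure L' := by
        refine integral_congr_ae ?_
        filter_upwards [coeFn_dilate (L' := L') u] with x hx
        simp only [hx, hderiv, flux, Finset.mul_sum, mul_left_comm]
    _ = L'⁻¹ * L * ∫ y, flux y ∂torusMeasure L := by
        rw [integral_const_mul, integral_dilation]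
    _ = 0 := by rw [hu _ hφ.comp_dilation, mul_zero]

theorem IsDivFree.smul {u : L2 L} (hu : IsDivFree u) (c : ℝ) : IsDivFree (c • u) := by
  intro φ hφ
  rw [← mul_zero c, ← hu φ hφ, ← integral_const_mul]
  refine integral_congr_ae ?_
  filter_upwards [Lp.coeFn_smul c u] with x hx
  simp only [hx, Pi.smul_apply, PiLp.smul_apply, smul_eq_mul, Finset.mul_sum, mul_assoc]

/-- The rescaling `u ↦ c u((L / L') ·)` of solenoidal fields. -/
def rescale (L L' : ℝ) [Fact (0 < L)] [Fact (0 < L')] (c : ℝ) (u : H L) : H L' :=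
  ⟨c • dilate L L' u.1, u.2.1.dilate.smul c, by
    rw [integral_congr_ae (Lp.coeFn_smul c _)]
    simp only [Pi.smul_apply, integral_smul, integral_dilate, u.2.2, smul_zero]⟩

theorem coe_rescale (c : ℝ) (u : H L) : (rescale L L' c u).1 = c • dilate L L' u.1 := rfl

theorem continuous_rescale (c : ℝ) : Continuous (rescale L L' c) :=
  (((dilate L L').continuous.comp continuous_subtype_val).const_smul c).subtype_mk _

theorem fourierCoef_rescale (c : ℝ) (u : H L) (m : Fin 3 → ℤ) :
    fourierCoef (rescale L L' c u).1 m = (c : ℂ) • fourierCoef u.1 m := by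
  rw [coe_rescale, fourierCoef_smul, fourierCoef_dilate]

theorem enorm_fourierCoef_rescale (c : ℝ) (u : H L) (m : Fin 3 → ℤ) :
    ‖fourierCoef (rescale L L' c u).1 m‖ₑ = ‖c‖ₑ * ‖fourierCoef u.1 m‖ₑ := by
  rw [fourierCoef_rescale, enorm_smul, enorm_eq_nnnorm, Complex.nnnorm_real, ← enorm_eq_nnnorm]

theorem rescale_mem_galerkinSpace (c : ℝ) {n : ℕ} {u : H L} (hu : u ∈ galerkinSpace L n) :
    rescale L L' c u ∈ galerkinSpace L' n := fun m hm => by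
  rw [fourierCoef_rescale, hu m hm, smul_zero]

/-! ### Rescaling of the Galerkin equation -/

theorem trigPoly_rescale (c : ℝ) (n : ℕ) (u : H L) (x : Torus L') :
    trigPoly n (rescale L L' c u).1 x = c • trigPoly n u.1 (dilation L' L x) := by
  ext j
  simp only [trigPoly, fourierCoef_rescale, character_dilation, PiLp.smul_apply, smul_eq_mul,
    ← Complex.re_ofReal_mul, Finset.mul_sum, mul_left_comm]

theorem laplace_smul_comp_dilation (c : ℝ) (v : Torus L → Vec) (x : Torus L') :
    laplace (fun y => c • v (dilation L' L y)) x =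
      (c * (L'⁻¹ * L) ^ 2) • laplace v (dilation L' L x) := by
  ext j
  simp only [laplace, PiLp.smul_apply, smul_eq_mul, Finset.mul_sum]
  refine Finset.sum_congr rfl fun i _ => ?_
  have hfirst : pderiv i (fun z => c * v (dilation L' L z) j) =
      fun y => c * (L'⁻¹ * L * pderiv i (fun z => v z j) (dilation L' L y)) := funext fun y => by
    rw [pderiv_const_mul, pderiv_comp_dilation i fun z => v z j]
  rw [hfirst, pderiv_const_mul, pderiv_const_mul, pderiv_comp_dilation i (pderiv i fun z => v z j)]
  ring

theorem advect_smul_comp_dilation (c : ℝ) (v : Torus L → Vec) (x : Torus L') :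
    advect (fun y => c • v (dilation L' L y)) (fun y => c • v (dilation L' L y)) x =
      (c ^ 2 * (L'⁻¹ * L)) • advect v v (dilation L' L x) := by
  ext j
  simp only [advect, PiLp.smul_apply, smul_eq_mul, pderiv_const_mul, Finset.mul_sum]
  refine Finset.sum_congr rfl fun i _ => ?_
  rw [pderiv_comp_dilation i fun z => v z j]
  ring

theorem noiseField_const_mul (σ : NoiseCoefficients) (n : ℕ) (c : ℝ)
    (b : (Fin 3 → ℤ) → Fin 3 → ℂ) (x : Torus L') :
    noiseField σ n (fun m j => (c : ℂ) * b m j) x = c • noiseField σ n b (dilation L' L x) := by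
  ext j
  simp only [noiseField, character_dilation, PiLp.smul_apply, smul_eq_mul,
    ← Complex.re_ofReal_mul, Finset.mul_sum]
  refine congrArg Complex.re (Finset.sum_congr rfl fun m _ => ?_)
  rw [show (fun j => (c : ℂ) * b m j) = (c : ℂ) • b m from rfl, Matrix.mulVec_smul,
    Pi.smul_apply, smul_eq_mul, mul_left_comm]

/-- The drift `ν Δv - (v · ∇)v` of the Galerkin equation, before projection. -/
def galerkinDrift {L : ℝ} (ν : ℝ) (v : Torus L → Vec) (x : Torus L) : Vec :=
  ν • laplace v x - advect v v x

theorem galerkinDrift_rescale {l ν ν' : ℝ} (hl : l ≠ 0) (hL : L'⁻¹ * L = l ^ 3)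
    (hν : ν' * l ^ 4 = ν) (n : ℕ) (u : H L) (x : Torus L') :
    galerkinDrift ν' (trigPoly n (rescale L L' l⁻¹ u).1) x =
      l • galerkinDrift ν (trigPoly n u.1) (dilation L' L x) := by
  rw [galerkinDrift, galerkinDrift, funext (trigPoly_rescale l⁻¹ n u), laplace_smul_comp_dilation,
    advect_smul_comp_dilation, hL, smul_sub, smul_smul, smul_smul, ← hν]
  congr 2 <;> field_simp

/-- The amplitude `l⁻¹` is what Brownian scaling attaches to the time `l² t`; balancing the time
derivative against advection then gives the space scale `l³`, and the Laplacian `ν / l⁴`. -/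
theorem IsGalerkinPath.rescale {σ : NoiseCoefficients} {ν ν' : ℝ} {n : ℕ}
    {b : (Fin 3 → ℤ) → Fin 3 → ℝ≥0 → ℂ} {v : ℝ≥0 → H L} (hv : IsGalerkinPath σ ν L n b v)
    {l : ℝ≥0} (hl : 0 < l) (hL : L'⁻¹ * L = l ^ 3) (hν : ν' * l ^ 4 = ν) :
    IsGalerkinPath σ ν' L' n (fun m j t => ((l⁻¹ : ℝ) : ℂ) * b m j (l ^ 2 * t))
      fun t => rescale L L' (l⁻¹ : ℝ) (v (l ^ 2 * t)) := by
  have hl0 : (l : ℝ) ≠ 0 := by exact_mod_cast hl.ne'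
  refine ⟨(continuous_rescale _).comp (hv.continuous.comp (by fun_prop)),
    fun t => rescale_mem_galerkinSpace _ (hv.mem _), fun w hw t => ?_⟩
  have hinner (u : H L) : inner ℝ (NSK41.rescale L L' (l⁻¹ : ℝ) u).1 w.1 =
      (l⁻¹ : ℝ) * inner ℝ u.1 (dilate L' L w.1) := by
    rw [coe_rescale, real_inner_smul_left, inner_dilate]
  let drift (s : ℝ) : ℝ := ∫ x, inner ℝ (galerkinDrift ν (trigPoly n (v s.toNNReal).1) x)
    (dilate L' L w.1 x) ∂torusMeasure L
  have hdrift (s : ℝ) : ∫ x, inner ℝ (galerkinDrift ν'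
      (trigPoly n (NSK41.rescale L L' (l⁻¹ : ℝ) (v (l ^ 2 * s.toNNReal))).1) x) (w.1 x)
        ∂torusMeasure L' = l * drift (l ^ 2 * s) := by
    have hs : (l ^ 2 * s : ℝ).toNNReal = l ^ 2 * s.toNNReal := by
      rw [Real.toNNReal_mul (by positivity), ← NNReal.coe_pow, Real.toNNReal_coe]
    simp only [galerkinDrift_rescale hl0 hL hν, integral_inner_smul_dilation, drift, hs]
  have hnoise := integral_inner_smul_dilation (L := L) (l⁻¹ : ℝ)
    (noiseField σ n fun m j => b m j (l ^ 2 * t)) w.1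
  simp only [← noiseField_const_mul] at hnoise
  have hone : (NSK41.rescale L' L 1 w).1 = dilate L' L w.1 := one_smul ℝ _
  have key := hv.equation _ (rescale_mem_galerkinSpace (L' := L) 1 hw) (l ^ 2 * t)
  rw [hone] at key
  change _ = _ + (∫ s in (0 : ℝ)..t, ∫ x, inner ℝ (galerkinDrift ν' _ x) _ ∂torusMeasure L') + _
  change _ = _ + (∫ s in (0 : ℝ)..(l ^ 2 * t : ℝ≥0), drift s) + _ at key
  rw [hnoise, hinner, hinner, key, mul_zero]
  simp only [hdrift]
  rw [intervalIntegral.integral_const_mul,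
    intervalIntegral.integral_comp_mul_left drift (pow_ne_zero 2 hl0), NNReal.coe_mul,
    NNReal.coe_pow, mul_zero, smul_eq_mul]
  field_simp

theorem IsDrivingNoise.rescale {Ω : Type} [MeasurableSpace Ω] {P : Measure Ω}
    {β : (Fin 3 → ℤ) → Fin 3 → ℝ≥0 → Ω → ℂ} (hβ : IsDrivingNoise P β) {l : ℝ≥0} (hl : 0 < l) :
    IsDrivingNoise P fun m j t ω => ((l⁻¹ : ℝ) : ℂ) * β m j (l ^ 2 * t) ω := by
  have hsqrt : √((l ^ 2 : ℝ≥0) : ℝ) = l := by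
    rw [NNReal.coe_pow, Real.sqrt_sq l.coe_nonneg]
  refine ⟨fun m j t => (hβ.measurable m j _).const_mul _, fun m j t ω => ?_, fun m j => ?_,
    fun m j => ?_, ?_⟩
  · rw [hβ.conj, map_mul, Complex.conj_ofReal]
  · convert (hβ.brownian_re m j).smul (pow_ne_zero 2 hl.ne') using 3
    rw [hsqrt, Complex.re_ofReal_mul]
    ring
  · convert (hβ.brownian_im m j).smul (pow_ne_zero 2 hl.ne') using 3
    rw [hsqrt, Complex.im_ofReal_mul]
    ring
  · convert hβ.indep.comp (fun _ f t => (l⁻¹ : ℝ) * f (l ^ 2 * t))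
      (fun _ => measurable_pi_lambda _ fun t => (measurable_pi_apply _).const_mul _) using 1
    ext q ω t
    simp only [Function.comp_apply, Complex.re_ofReal_mul, Complex.im_ofReal_mul, mul_ite]

/-- The law of the rescaled field. -/
def rescaleLaw (L L' : ℝ) [Fact (0 < L)] [Fact (0 < L')] (c : ℝ) (μ : ProbabilityMeasure (H L)) :
    ProbabilityMeasure (H L') :=
  μ.map (continuous_rescale (L := L) (L' := L') c).measurable.aemeasurable

theorem coe_rescaleLaw (c : ℝ) (μ : ProbabilityMeasure (H L)) :
    (rescaleLaw L L' c μ : Measure (H L')) = (μ : Measure (H L)).map (rescale L L' c) := rfl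

theorem IsGalerkinInvariant.rescale {σ : NoiseCoefficients} {ν ν' : ℝ} {n : ℕ}
    {μ : ProbabilityMeasure (H L)} (hμ : IsGalerkinInvariant σ ν L n μ)
    {l : ℝ≥0} (hl : 0 < l) (hL : L'⁻¹ * L = l ^ 3) (hν : ν' * l ^ 4 = ν) :
    IsGalerkinInvariant σ ν' L' n (rescaleLaw L L' (l⁻¹ : ℝ) μ) := by
  obtain ⟨Ω, _, P, _, β, u, hβ, hu, hindep, hpath, hlaw⟩ := hμ
  have hmeas := (continuous_rescale (L := L) (L' := L') (l⁻¹ : ℝ)).measurable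
  refine ⟨Ω, _, P, ‹_›, fun m j t ω => ((l⁻¹ : ℝ) : ℂ) * β m j (l ^ 2 * t) ω,
    fun t ω => NSK41.rescale L L' (l⁻¹ : ℝ) (u (l ^ 2 * t) ω), hβ.rescale hl,
    fun t => hmeas.comp (hu _), ?_, ?_, fun t => ?_⟩
  · have hnoise : Measurable fun (b : (Fin 3 → ℤ) → Fin 3 → ℝ≥0 → ℂ) m j (t : ℝ≥0) =>
        ((l⁻¹ : ℝ) : ℂ) * b m j (l ^ 2 * t) := by
      fun_prop
    simpa only [mul_zero, Function.comp_def] using hindep.comp hmeas hnoise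
  · filter_upwards [hpath] with ω hω
    exact hω.rescale hl hL hν
  · rw [coe_rescaleLaw, ← hlaw (l ^ 2 * t), Measure.map_map hmeas (hu _), Function.comp_def]

end Rescale

/-! ### Fourier series on the torus -/

theorem enorm_pow_eq_ofReal {E : Type*} [SeminormedAddCommGroup E] (x : E) (n : ℕ) :
    ‖x‖ₑ ^ n = ENNReal.ofReal (‖x‖ ^ n) := by
  rw [ENNReal.ofReal_pow (norm_nonneg x), ofReal_norm]

theorem enorm_sq_eq_sum {𝕜 ι : Type*} [RCLike 𝕜] [Fintype ι] (v : EuclideanSpace 𝕜 ι) :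
    ‖v‖ₑ ^ 2 = ∑ j, ‖v j‖ₑ ^ 2 := by
  simp only [enorm_pow_eq_ofReal]
  rw [EuclideanSpace.norm_sq_eq, ENNReal.ofReal_sum_of_nonneg fun _ _ => by positivity]

theorem lintegral_enorm_sq {α E : Type*} [MeasurableSpace α] [NormedAddCommGroup E]
    {μ : Measure α} (f : Lp E 2 μ) : ∫⁻ x, ‖f x‖ₑ ^ 2 ∂μ = ‖f‖ₑ ^ 2 := by
  simpa [Lp.enorm_def] using (eLpNorm_nnreal_pow_eq_lintegral (f := f) (μ := μ) two_ne_zero).symm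

section Character

variable {L : ℝ}

theorem continuous_character (m : Fin 3 → ℤ) : Continuous (character (L := L) m) :=
  continuous_finsetProd _ fun j _ => (map_continuous (fourier (m j))).comp (continuous_apply j)

theorem norm_character (m : Fin 3 → ℤ) (x : Torus L) : ‖character m x‖ = 1 := by
  simp [character, fourier_apply, Circle.norm_coe]

theorem character_add (m : Fin 3 → ℤ) (x y : Torus L) :
    character m (x + y) = character m x * character m y := by
  simp [character, fourier_apply, AddCircle.toCircle_add, Finset.prod_mul_distrib]

theorem character_single (m : Fin 3 → ℤ) (i : Fin 3) (t : ℝ) :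
    character m (Pi.single i (t : AddCircle L)) =
      Complex.exp (Complex.I * ((t * wave L m i : ℝ) : ℂ)) := by
  rw [character, Finset.prod_eq_single i (fun j _ hj => by simp [Pi.single_eq_of_ne hj]) (by simp),
    Pi.single_eq_same, fourier_coe_apply, wave]
  congr 1
  push_cast
  ring

theorem enorm_character_single_sub_one_sq (m : Fin 3 → ℤ) (i : Fin 3) (t : ℝ) :
    ‖character m (Pi.single i (t : AddCircle L)) - 1‖ₑ ^ 2 =
      ENNReal.ofReal (2 - 2 * Real.cos (t * wave L m i)) := by
  rw [enorm_pow_eq_ofReal, character_single, Complex.norm_exp_I_mul_ofReal_sub_one,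
    Real.norm_eq_abs, sq_abs, mul_pow, Real.sin_sq_eq_half_sub]
  congr 1
  ring_nf

end Character

section Fourier

variable {L : ℝ} [Fact (0 < L)]

theorem memLp_coord (u : L2 L) (j : Fin 3) :
    MemLp (fun x => (u x j : ℂ)) 2 (torusMeasure L) :=
  ((Lp.memLp u).continuousLinearMap_comp (EuclideanSpace.proj j : Vec →L[ℝ] ℝ)).ofReal

theorem tsum_enorm_sq_fourierCoef_unit_apply (u : L2 1) (j : Fin 3) :
    ∑' m, ‖fourierCoef u m j‖ₑ ^ 2 = ∫⁻ x, ‖u x j‖ₑ ^ 2 ∂torusMeasure 1 := by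
  set f : Lp ℂ 2 (torusMeasure 1) := (memLp_coord u j).toLp _
  have hf : ⇑f =ᵐ[torusMeasure 1] fun x => (u x j : ℂ) := (memLp_coord u j).coeFn_toLp
  have hcoef (m : Fin 3 → ℤ) : UnitAddTorus.mFourierCoeff f m = fourierCoef u (-m) j := by
    refine integral_congr_ae ?_
    filter_upwards [hf] with x hx
    rw [hx]
    rfl
  have hsum : HasSum (fun m => ‖UnitAddTorus.mFourierCoeff f m‖ ^ 2)
      (∫ x, ‖f x‖ ^ 2 ∂torusMeasure 1) := UnitAddTorus.hasSum_sq_mFourierCoeff f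
  calc ∑' m, ‖fourierCoef u m j‖ₑ ^ 2
      = ∑' m, ‖UnitAddTorus.mFourierCoeff f m‖ₑ ^ 2 := by
        simp only [hcoef]
        exact ((Equiv.neg (Fin 3 → ℤ)).tsum_eq fun m => ‖fourierCoef u m j‖ₑ ^ 2).symm
    _ = ENNReal.ofReal (∫ x, ‖f x‖ ^ 2 ∂torusMeasure 1) := by
        simp only [enorm_pow_eq_ofReal]
        rw [← ENNReal.ofReal_tsum_of_nonneg (fun _ => by positivity) hsum.summable, hsum.tsum_eq]
    _ = ∫⁻ x, ‖f x‖ₑ ^ 2 ∂torusMeasure 1 := by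
        simp only [enorm_pow_eq_ofReal]
        exact ofReal_integral_eq_lintegral_ofReal
          ((Lp.memLp f).integrable_norm_pow two_ne_zero) (ae_of_all _ fun x => by positivity)
    _ = ∫⁻ x, ‖u x j‖ₑ ^ 2 ∂torusMeasure 1 := by
        refine lintegral_congr_ae ?_
        filter_upwards [hf] with x hx
        rw [hx, ← ofReal_norm, Complex.norm_real, ofReal_norm]

theorem tsum_enorm_sq_fourierCoef_unit (u : L2 1) : ∑' m, ‖fourierCoef u m‖ₑ ^ 2 = ‖u‖ₑ ^ 2 := by
  rw [← lintegral_enorm_sq]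
  simp only [enorm_sq_eq_sum]
  have hmeas (j : Fin 3) : AEMeasurable (fun x => ‖u x j‖ₑ ^ 2) (torusMeasure 1) :=
    (((EuclideanSpace.proj j : Vec →L[ℝ] ℝ).continuous.comp_aestronglyMeasurable
      (Lp.aestronglyMeasurable u)).enorm).pow_const 2
  rw [Summable.tsum_finsetSum fun _ _ => ENNReal.summable,
    lintegral_finsetSum' _ fun j _ => hmeas j]
  exact Finset.sum_congr rfl fun j _ => tsum_enorm_sq_fourierCoef_unit_apply u j

theorem tsum_enorm_sq_fourierCoef (u : L2 L) : ∑' m, ‖fourierCoef u m‖ₑ ^ 2 = ‖u‖ₑ ^ 2 := by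
  simpa only [fourierCoef_dilate, LinearIsometry.enorm_map] using
    tsum_enorm_sq_fourierCoef_unit (dilate L 1 u)

theorem enorm_fourierCoef_le (u : L2 L) (m : Fin 3 → ℤ) : ‖fourierCoef u m‖ₑ ≤ ‖u‖ₑ := by
  rw [← ENNReal.pow_le_pow_left_iff two_ne_zero, ← tsum_enorm_sq_fourierCoef]
  exact ENNReal.le_tsum (f := fun m => ‖fourierCoef u m‖ₑ ^ 2) m

theorem integrable_character_mul (u : L2 L) (m : Fin 3 → ℤ) (j : Fin 3) :
    Integrable (fun x => character m x * (u x j : ℂ)) (torusMeasure L) :=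
  ((memLp_coord u j).integrable one_le_two).bdd_mul (c := 1)
    (continuous_character m).aestronglyMeasurable (ae_of_all _ fun x => (norm_character m x).le)

theorem fourierCoef_add (u v : L2 L) (m : Fin 3 → ℤ) :
    fourierCoef (u + v) m = fourierCoef u m + fourierCoef v m := by
  ext j
  simp only [fourierCoef, PiLp.add_apply]
  rw [← integral_add (integrable_character_mul u m j) (integrable_character_mul v m j)]
  refine integral_congr_ae ?_
  filter_upwards [Lp.coeFn_add u v] with x hx
  rw [hx, Pi.add_apply, PiLp.add_apply, Complex.ofReal_add, mul_add]

/-- The `m`-th Fourier coefficient as a continuous linear map. -/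
def fourierCoefL (L : ℝ) [Fact (0 < L)] (m : Fin 3 → ℤ) : L2 L →L[ℝ] EuclideanSpace ℂ (Fin 3) :=
  LinearMap.mkContinuous
    { toFun := fun u => fourierCoef u m
      map_add' := fun u v => fourierCoef_add u v m
      map_smul' := fun c u => fourierCoef_smul c u m } 1 fun u => by
    rw [one_mul]
    exact enorm_le_iff_norm_le.1 (enorm_fourierCoef_le u m)

theorem continuous_fourierCoef (m : Fin 3 → ℤ) : Continuous fun u : L2 L => fourierCoef u m :=
  (fourierCoefL L m).continuous

theorem fourierCoef_sub (u v : L2 L) (m : Fin 3 → ℤ) :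
    fourierCoef (u - v) m = fourierCoef u m - fourierCoef v m :=
  (fourierCoefL L m).map_sub u v

theorem coeFn_translate (a : Torus L) (u : L2 L) :
    translate a u =ᵐ[torusMeasure L] fun x => u (x - a) :=
  Lp.coeFn_compMeasurePreserving u (measurePreserving_sub L a)

theorem fourierCoef_translate (a : Torus L) (u : L2 L) (m : Fin 3 → ℤ) :
    fourierCoef (translate a u) m = character m a • fourierCoef u m := by
  ext j
  simp only [fourierCoef, PiLp.smul_apply, smul_eq_mul]
  rw [← integral_const_mul, ← integral_sub_right_eq_self
    (fun y => character m a * (character m y * (u y j : ℂ))) a]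
  refine integral_congr_ae ?_
  filter_upwards [coeFn_translate a u] with x hx
  rw [hx, ← mul_assoc, ← character_add, add_sub_cancel]

theorem lintegral_enorm_sub_translate_sq (u : L2 L) (a : Torus L) :
    ∫⁻ x, ‖u (x + a) - u x‖ₑ ^ 2 ∂torusMeasure L =
      ∑' m, ‖character m (-a) - 1‖ₑ ^ 2 * ‖fourierCoef u m‖ₑ ^ 2 := by
  calc ∫⁻ x, ‖u (x + a) - u x‖ₑ ^ 2 ∂torusMeasure L
      = ∫⁻ x, ‖(translate (-a) u - u) x‖ₑ ^ 2 ∂torusMeasure L := by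
        refine lintegral_congr_ae ?_
        filter_upwards [coeFn_translate (-a) u, Lp.coeFn_sub (translate (-a) u) u] with x hx hsub
        rw [hsub, Pi.sub_apply, hx, sub_neg_eq_add]
    _ = ∑' m, ‖fourierCoef (translate (-a) u - u) m‖ₑ ^ 2 := by
        rw [lintegral_enorm_sq, tsum_enorm_sq_fourierCoef]
    _ = ∑' m, ‖character m (-a) - 1‖ₑ ^ 2 * ‖fourierCoef u m‖ₑ ^ 2 := by
        refine tsum_congr fun m => ?_
        rw [fourierCoef_sub, fourierCoef_translate, ← mul_pow, ← enorm_smul, sub_smul, one_smul]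

theorem lintegral_enorm_increment_sq (u : L2 L) (i : Fin 3) (t : ℝ) :
    ∫⁻ x, ‖u (x + Pi.single i (t : AddCircle L)) - u x‖ₑ ^ 2 ∂torusMeasure L =
      ∑' m, ENNReal.ofReal (2 - 2 * Real.cos (t * wave L m i)) * ‖fourierCoef u m‖ₑ ^ 2 := by
  rw [lintegral_enorm_sub_translate_sq]
  simp only [← Pi.single_neg, ← AddCircle.coe_neg, enorm_character_single_sub_one_sq, neg_mul,
    Real.cos_neg]

end Fourier

/-! ### Laws of random fields -/

section Law

variable {Ω Ω' E : Type*} [MeasurableSpace Ω] [MeasurableSpace Ω'] [TopologicalSpace E]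
  [MeasurableSpace E] [BorelSpace E]

theorem identDistrib_iff_forall_integral_eq [HasOuterApproxClosed E] {P : Measure Ω}
    {P' : Measure Ω'} [IsFiniteMeasure P] [IsFiniteMeasure P'] {X : Ω → E} {Y : Ω' → E}
    (hX : AEMeasurable X P) (hY : AEMeasurable Y P') :
    IdentDistrib X Y P P' ↔ ∀ f : E →ᵇ ℝ, ∫ ω, f (X ω) ∂P = ∫ ω, f (Y ω) ∂P' := by
  refine ⟨fun h f => (h.comp f.continuous.measurable).integral_eq, fun h => ⟨hX, hY, ?_⟩⟩
  refine ext_of_forall_integral_eq_of_IsFiniteMeasure fun f => ?_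
  rw [integral_map hX f.continuous.measurable.aestronglyMeasurable,
    integral_map hY f.continuous.measurable.aestronglyMeasurable, h]

theorem identDistrib_of_tendsto [HasOuterApproxClosed E] [TopologicalSpace Ω]
    [OpensMeasurableSpace Ω] {ι : Type*} {l : Filter ι} [l.NeBot] {P : ι → ProbabilityMeasure Ω}
    {P₀ : ProbabilityMeasure Ω} (hlim : Tendsto P l (𝓝 P₀)) {X Y : Ω → E} (hX : Continuous X)
    (hY : Continuous Y) (h : ∀ i, IdentDistrib X Y (P i : Measure Ω) (P i : Measure Ω)) :
    IdentDistrib X Y (P₀ : Measure Ω) (P₀ : Measure Ω) := by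
  refine ⟨hX.aemeasurable, hY.aemeasurable, ?_⟩
  have hXlim := ((ProbabilityMeasure.continuous_map hX).tendsto P₀).comp hlim
  have hYlim := ((ProbabilityMeasure.continuous_map hY).tendsto P₀).comp hlim
  have hmap (i : ι) : (P i).map hX.aemeasurable = (P i).map hY.aemeasurable :=
    Subtype.ext (h i).map_eq
  simp only [Function.comp_def, hmap] at hXlim hYlim
  have heq : P₀.map hX.aemeasurable = P₀.map hY.aemeasurable := tendsto_nhds_unique hXlim hYlim
  exact congrArg ((↑) : ProbabilityMeasure E → Measure E) heq

end Law

theorem identDistrib_map {Ω Ω₁ E : Type*} [MeasurableSpace Ω] [MeasurableSpace Ω₁]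
    [MeasurableSpace E] {P : Measure Ω} {φ : Ω → Ω₁} {X Y : Ω₁ → E} (hφ : Measurable φ)
    (hX : Measurable X) (hY : Measurable Y) (h : IdentDistrib (X ∘ φ) (Y ∘ φ) P P) :
    IdentDistrib X Y (P.map φ) (P.map φ) :=
  ⟨hX.aemeasurable, hY.aemeasurable, by
    rw [Measure.map_map hX hφ, Measure.map_map hY hφ, h.map_eq]⟩

instance (L : ℝ) [Fact (0 < L)] : MeasurableSpace (L2 L) := borel (L2 L)

instance (L : ℝ) [Fact (0 < L)] : BorelSpace (L2 L) := ⟨rfl⟩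

/-- Space homogeneous laws: `u(· - a)` and `u` have the same law in `𝕃²` for every `a`. -/
def IsHomogeneous {L : ℝ} [Fact (0 < L)] (μ : ProbabilityMeasure (H L)) : Prop :=
  ∀ a : Torus L, IdentDistrib (fun u : H L => translate a u.1) (fun u => u.1)
    (μ : Measure (H L)) (μ : Measure (H L))

/-- Discretely isotropic laws: `u(R ·)` and `R u(·)` have the same law in `𝕃²` for every
coordinate rotation `R`. -/
def IsIsotropic {L : ℝ} [Fact (0 < L)] (μ : ProbabilityMeasure (H L)) : Prop :=
  ∀ R : CoordRotation, IdentDistrib (fun u : H L => rotateArgument R u.1)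
    (fun u => rotateValue R u.1) (μ : Measure (H L)) (μ : Measure (H L))

section Symmetry

variable {L L' : ℝ} [Fact (0 < L)] [Fact (0 < L')]

theorem continuous_uncurry_translate :
    Continuous fun p : Torus L × L2 L => translate p.1 p.2 :=
  Continuous.compMeasurePreservingLp (f := fun p : Torus L × L2 L => p.2)
    (g := fun p : Torus L × L2 L => (⟨fun x => x - p.1, by fun_prop⟩ : C(Torus L, Torus L)))
    continuous_snd (ContinuousMap.continuous_of_continuous_uncurry _
      (show Continuous fun q : (Torus L × L2 L) × Torus L => q.2 - q.1.1 by fun_prop))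
    (fun p => measurePreserving_sub L p.1) ENNReal.ofNat_ne_top

theorem continuous_translate (a : Torus L) : Continuous (translate a) :=
  continuous_uncurry_translate.comp (Continuous.prodMk_right a)

theorem continuous_rotateArgument (R : CoordRotation) :
    Continuous (rotateArgument (L := L) R) :=
  (Lp.isometry_compMeasurePreserving (measurePreserving_torusRotation L R)).continuous

theorem continuous_rotateValue (R : CoordRotation) : Continuous (rotateValue (L := L) R) :=
  ((Matrix.toEuclideanCLM (n := Fin 3) (𝕜 := ℝ) (R.1.map (Int.cast : ℤ → ℝ))).compLpL 2
    (torusMeasure L)).continuous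

theorem isHomogeneous_iff_forall_integral_eq {μ : ProbabilityMeasure (H L)} :
    IsHomogeneous μ ↔ ∀ (a : Torus L) (f : L2 L →ᵇ ℝ),
      ∫ u, f (translate a u.1) ∂(μ : Measure (H L)) = ∫ u, f u.1 ∂(μ : Measure (H L)) :=
  forall_congr' fun a => identDistrib_iff_forall_integral_eq
    ((continuous_translate a).comp continuous_subtype_val).aemeasurable
    continuous_subtype_val.aemeasurable

theorem isIsotropic_iff_forall_integral_eq {μ : ProbabilityMeasure (H L)} :
    IsIsotropic μ ↔ ∀ (R : CoordRotation) (f : L2 L →ᵇ ℝ),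
      ∫ u, f (rotateArgument R u.1) ∂(μ : Measure (H L)) =
        ∫ u, f (rotateValue R u.1) ∂(μ : Measure (H L)) :=
  forall_congr' fun R => identDistrib_iff_forall_integral_eq
    ((continuous_rotateArgument R).comp continuous_subtype_val).aemeasurable
    ((continuous_rotateValue R).comp continuous_subtype_val).aemeasurable

theorem IsHomogeneous.of_tendsto {ι : Type*} {l : Filter ι} [l.NeBot]
    {μs : ι → ProbabilityMeasure (H L)} {μ : ProbabilityMeasure (H L)}
    (hlim : Tendsto μs l (𝓝 μ)) (h : ∀ i, IsHomogeneous (μs i)) : IsHomogeneous μ := fun a =>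
  identDistrib_of_tendsto hlim ((continuous_translate a).comp continuous_subtype_val)
    continuous_subtype_val fun i => h i a

theorem IsIsotropic.of_tendsto {ι : Type*} {l : Filter ι} [l.NeBot]
    {μs : ι → ProbabilityMeasure (H L)} {μ : ProbabilityMeasure (H L)}
    (hlim : Tendsto μs l (𝓝 μ)) (h : ∀ i, IsIsotropic (μs i)) : IsIsotropic μ := fun R =>
  identDistrib_of_tendsto hlim ((continuous_rotateArgument R).comp continuous_subtype_val)
    ((continuous_rotateValue R).comp continuous_subtype_val) fun i => h i R

theorem IsHomogeneous.rescale {μ : ProbabilityMeasure (H L)} (h : IsHomogeneous μ) (c : ℝ) :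
    IsHomogeneous (rescaleLaw L L' c μ) := fun a =>
  identDistrib_map (continuous_rescale c).measurable
    ((continuous_translate a).comp continuous_subtype_val).measurable
    continuous_subtype_val.measurable <| by
      simpa only [Function.comp_def, coe_rescale, Pi.smul_apply, translate_smul,
        translate_dilate] using
        (h (dilation L' L a)).comp ((dilate L L').continuous.const_smul c).measurable

theorem IsIsotropic.rescale {μ : ProbabilityMeasure (H L)} (h : IsIsotropic μ) (c : ℝ) :
    IsIsotropic (rescaleLaw L L' c μ) := fun R =>
  identDistrib_map (continuous_rescale c).measurable
    ((continuous_rotateArgument R).comp continuous_subtype_val).measurable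
    ((continuous_rotateValue R).comp continuous_subtype_val).measurable <| by
      simpa only [Function.comp_def, coe_rescale, Pi.smul_apply, rotateArgument_smul,
        rotateArgument_dilate, rotateValue_smul, rotateValue_dilate] using
        (h R).comp ((dilate L L').continuous.const_smul c).measurable

/-! ### Rescaling of the class `𝒫_L` and of the stationary measures -/

theorem tsum_wave_pow_mul_fourierCoef_rescale (p : ℕ) (c : ℝ) (u : H L) :
    ∑' m, ‖wave L' m‖ₑ ^ p * ‖fourierCoef (rescale L L' c u).1 m‖ₑ ^ 2 =
      ‖L'⁻¹ * L‖ₑ ^ p * ‖c‖ₑ ^ 2 * ∑' m, ‖wave L m‖ₑ ^ p * ‖fourierCoef u.1 m‖ₑ ^ 2 := by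
  rw [← ENNReal.tsum_mul_left]
  refine tsum_congr fun m => ?_
  rw [enorm_fourierCoef_rescale, wave_eq_smul (Fact.out : 0 < L).ne', enorm_smul]
  ring

theorem InClassP.rescale {μ : ProbabilityMeasure (H L)} (hμ : InClassP L μ) (c : ℝ) :
    InClassP L' (rescaleLaw L L' c μ) := by
  have hmeas := (continuous_rescale (L := L) (L' := L') c).measurable
  have hfin (p : ℕ) : ‖L'⁻¹ * L‖ₑ ^ p * ‖c‖ₑ ^ 2 < ∞ :=
    ENNReal.mul_lt_top (ENNReal.pow_lt_top enorm_lt_top) (ENNReal.pow_lt_top enorm_lt_top)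
  have hsum (p : ℕ) : Measurable fun u : H L' =>
      ∑' m, ‖wave L' m‖ₑ ^ p * ‖fourierCoef u.1 m‖ₑ ^ 2 :=
    Measurable.tsum fun m =>
      ((((continuous_fourierCoef m).comp continuous_subtype_val).enorm.measurable).pow_const
        2).const_mul _
  have hdomain : MeasurableSet (stokesDomain L') := measurableSet_lt (hsum 4) measurable_const
  refine ⟨?_, ?_, ?_, ?_⟩
  · rw [coe_rescaleLaw, ae_map_iff (p := (· ∈ stokesDomain L')) hmeas.aemeasurable hdomain]
    filter_upwards [hμ.domain] with u hu
    simp only [stokesDomain, Set.mem_ofPred_eq, tsum_wave_pow_mul_fourierCoef_rescale] at hu ⊢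
    exact ENNReal.mul_lt_top (hfin 4) hu
  · rw [coe_rescaleLaw]
    simp only [dirichletEnergy]
    rw [lintegral_map (hsum 2) hmeas]
    simp only [tsum_wave_pow_mul_fourierCoef_rescale]
    rw [lintegral_const_mul' _ _ (hfin 2).ne]
    exact ENNReal.mul_lt_top (hfin 2) hμ.finite_enstrophy
  · exact isHomogeneous_iff_forall_integral_eq.1
      ((isHomogeneous_iff_forall_integral_eq.2 hμ.homogeneous).rescale c)
  · exact isIsotropic_iff_forall_integral_eq.1
      ((isIsotropic_iff_forall_integral_eq.2 hμ.isotropic).rescale c)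

theorem rescaleLaw_mem_stationaryNS {σ : NoiseCoefficients} {ν ν' : ℝ}
    {μ : ProbabilityMeasure (H L)} (hμ : μ ∈ stationaryNS σ ν L)
    {l : ℝ≥0} (hl : 0 < l) (hL : L'⁻¹ * L = l ^ 3) (hν : ν' * l ^ 4 = ν) :
    rescaleLaw L L' (l⁻¹ : ℝ) μ ∈ stationaryNS σ ν' L' := by
  obtain ⟨k, μs, hk, hmem, hlim⟩ := hμ
  exact ⟨k, fun i => rescaleLaw L L' (l⁻¹ : ℝ) (μs i), hk,
    fun i => ⟨(hmem i).1.rescale _, (hmem i).2.rescale hl hL hν⟩,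
    ((ProbabilityMeasure.continuous_map (continuous_rescale _)).tendsto μ).comp hlim⟩

theorem isHomogeneous_of_mem_stationaryNS {σ : NoiseCoefficients} {ν : ℝ}
    {μ : ProbabilityMeasure (H L)} (hμ : μ ∈ stationaryNS σ ν L) : IsHomogeneous μ := by
  obtain ⟨k, μs, -, hmem, hlim⟩ := hμ
  exact .of_tendsto hlim fun i => isHomogeneous_iff_forall_integral_eq.2 (hmem i).1.homogeneous

theorem isIsotropic_of_mem_stationaryNS {σ : NoiseCoefficients} {ν : ℝ}
    {μ : ProbabilityMeasure (H L)} (hμ : μ ∈ stationaryNS σ ν L) : IsIsotropic μ := by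
  obtain ⟨k, μs, -, hmem, hlim⟩ := hμ
  exact .of_tendsto hlim fun i => isIsotropic_iff_forall_integral_eq.2 (hmem i).1.isotropic

end Symmetry

/-! ### Point values of square integrable fields -/

theorem continuous_setIntegral_L2 {α E : Type*} [MeasurableSpace α] [NormedAddCommGroup E]
    [InnerProductSpace ℝ E] [FiniteDimensional ℝ E] {μ : Measure α} {s : Set α}
    (hs : MeasurableSet s) (hμs : μ s ≠ ∞) :
    Continuous fun u : Lp E 2 μ => ∫ y in s, u y ∂μ := by
  have heq : (fun u : Lp E 2 μ => ∫ y in s, u y ∂μ) = fun u => ∑ j,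
      inner ℝ (indicatorConstLp 2 hs hμs (stdOrthonormalBasis ℝ E j)) u •
        stdOrthonormalBasis ℝ E j := by
    ext1 u
    simp only [L2.inner_indicatorConstLp_eq_inner_setIntegral, OrthonormalBasis.sum_repr']
  rw [heq]
  fun_prop

section PointValue

variable {L : ℝ} [Fact (0 < L)]

/-- The average of `u` over the cube of radius `1 / (n + 1)` around `x`; the point value `u(x)` is
the limit of these averages. -/
def cubeAverage (n : ℕ) (x : Torus L) (u : L2 L) : Vec :=
  ⨍ y in Metric.ball x (1 / ((n : ℝ) + 1)), u y ∂torusMeasure L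

theorem continuous_cubeAverage (n : ℕ) (x : Torus L) : Continuous (cubeAverage n x) := by
  have hint := continuous_setIntegral_L2 (E := Vec) (μ := torusMeasure L)
    (Metric.isOpen_ball (x := x) (ε := 1 / ((n : ℝ) + 1))).measurableSet (measure_ne_top _ _)
  refine (hint.const_smul ((torusMeasure L).real (Metric.ball x (1 / ((n : ℝ) + 1))))⁻¹).congr
    fun u => (setAverage_eq _ _ _).symm

theorem cubeAverage_translate (n : ℕ) (a x : Torus L) (u : L2 L) :
    cubeAverage n x (translate a u) = cubeAverage n (x - a) u := by
  have hpre : (fun y => y - a) ⁻¹' Metric.ball (x - a) (1 / ((n : ℝ) + 1)) =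
      Metric.ball x (1 / ((n : ℝ) + 1)) := by
    ext y
    simp [Metric.mem_ball]
  have hmp := (measurePreserving_sub L a).restrict_preimage_emb (measurableEmbedding_subRight a)
    (Metric.ball (x - a) (1 / ((n : ℝ) + 1)))
  rw [hpre] at hmp
  rw [cubeAverage, average_congr (ae_restrict_of_ae (coeFn_translate a u)), cubeAverage,
    average_eq, average_eq, ← hmp.measureReal_preimage (s := Set.univ) .univ, Set.preimage_univ,
    hmp.integral_comp (measurableEmbedding_subRight a) fun y => u y]

open Classical in
theorem pointValue_eq_ite_limUnder (u : L2 L) (x : Torus L) :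
    pointValue u x = if ∃ a, Tendsto (fun n => cubeAverage n x u) atTop (𝓝 a) then
      limUnder atTop fun n => cubeAverage n x u else 0 := by
  split_ifs with h
  · exact (dif_pos h).trans (h.choose_spec.limUnder_eq).symm
  · exact dif_neg h

theorem pointValue_eq_of_tendsto {u : L2 L} {x : Torus L} {a : Vec}
    (h : Tendsto (fun n => cubeAverage n x u) atTop (𝓝 a)) : pointValue u x = a := by
  rw [pointValue_eq_ite_limUnder, if_pos ⟨a, h⟩, h.limUnder_eq]

theorem pointValue_translate (a x : Torus L) (u : L2 L) :
    pointValue (translate a u) x = pointValue u (x - a) := by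
  have h : (fun n => cubeAverage n x (translate a u)) = fun n => cubeAverage n (x - a) u :=
    funext fun n => cubeAverage_translate n a x u
  rw [pointValue_eq_ite_limUnder, pointValue_eq_ite_limUnder, h]

theorem measurable_pointValue (x : Torus L) : Measurable fun u : L2 L => pointValue u x := by
  have hmeas (n : ℕ) : StronglyMeasurable (cubeAverage (L := L) n x) :=
    (continuous_cubeAverage n x).measurable.stronglyMeasurable
  simp only [pointValue_eq_ite_limUnder]
  exact (StronglyMeasurable.limUnder hmeas).measurable.ite
    (StronglyMeasurable.measurableSet_exists_tendsto hmeas) measurable_const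

theorem haarAddCircle_eq_smul_volume :
    (AddCircle.haarAddCircle : Measure (AddCircle L)) = (ENNReal.ofReal L)⁻¹ • volume := by
  rw [AddCircle.volume_eq_smul_haarAddCircle, smul_smul, ENNReal.inv_mul_cancel, one_smul]
  · simpa using (Fact.out : 0 < L)
  · exact ENNReal.ofReal_ne_top

instance : IsUnifLocDoublingMeasure (AddCircle.haarAddCircle : Measure (AddCircle L)) := by
  obtain ⟨C, hC⟩ := IsUnifLocDoublingMeasure.exists_measure_closedBall_le_mul''
    (μ := (volume : Measure (AddCircle L)))
  refine ⟨C, hC.mono fun ε hε x => ?_⟩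
  simp only [haarAddCircle_eq_smul_volume, Measure.smul_apply, smul_eq_mul]
  rw [mul_left_comm]
  gcongr
  exact hε x

instance : IsUnifLocDoublingMeasure (torusMeasure L) := by
  unfold torusMeasure
  infer_instance

theorem closedBall_ae_eq_ball_torus (x : Torus L) {r : ℝ} (hr : 0 < r) :
    Metric.closedBall x r =ᵐ[torusMeasure L] Metric.ball x r := by
  rw [closedBall_pi _ hr.le, ball_pi _ hr]
  refine Measure.ae_eq_set_pi fun j _ => ?_
  rw [haarAddCircle_eq_smul_volume]
  exact Measure.ae_smul_measure AddCircle.closedBall_ae_eq_ball _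

theorem pointValue_ae_eq (u : L2 L) : pointValue u =ᵐ[torusMeasure L] u := by
  have hint : LocallyIntegrable u (torusMeasure L) :=
    ((Lp.memLp u).integrable one_le_two).locallyIntegrable
  have hpos (n : ℕ) : (0 : ℝ) < 1 / ((n : ℝ) + 1) := Nat.one_div_pos_of_nat
  have hradius : Tendsto (fun n : ℕ => 1 / ((n : ℝ) + 1)) atTop (𝓝[>] 0) :=
    tendsto_nhdsWithin_iff.2 ⟨tendsto_one_div_add_atTop_nhds_zero_nat, .of_forall hpos⟩
  filter_upwards [IsUnifLocDoublingMeasure.ae_tendsto_average (torusMeasure L) hint 1] with x hx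
  refine pointValue_eq_of_tendsto ((hx (fun _ => x) _ hradius (.of_forall fun n =>
    Metric.mem_closedBall_self (by simpa using (hpos n).le))).congr fun n => ?_)
  exact setAverage_congr (closedBall_ae_eq_ball_torus x (hpos n))

end PointValue

/-! ### Mean square increments and mode energies of symmetric laws -/

section Homogeneous

variable {L : ℝ} [Fact (0 < L)]

theorem lintegral_pointValue_translate_increment (u : L2 L) (e : Torus L) :
    ∫⁻ a, ‖pointValue (translate (-a) u) e - pointValue (translate (-a) u) 0‖ₑ ^ 2
        ∂torusMeasure L = ∫⁻ x, ‖u (x + e) - u x‖ₑ ^ 2 ∂torusMeasure L := by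
  refine lintegral_congr_ae ?_
  filter_upwards [pointValue_ae_eq u, (measurePreserving_add_right (torusMeasure L)
    e).quasiMeasurePreserving.ae_eq_comp (pointValue_ae_eq u)] with a ha hae
  simp only [Function.comp_apply] at hae
  rw [pointValue_translate, pointValue_translate, sub_neg_eq_add, sub_neg_eq_add, zero_add,
    add_comm e a, ha, hae]

theorem measurable_fourierCoef (m : Fin 3 → ℤ) : Measurable fun u : L2 L => fourierCoef u m :=
  (continuous_fourierCoef m).measurable

variable {μ : ProbabilityMeasure (H L)}

theorem IsHomogeneous.lintegral_lintegral_translate (hμ : IsHomogeneous μ) {g : L2 L → ℝ≥0∞}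
    (hg : Measurable g) :
    ∫⁻ u, ∫⁻ a, g (translate (-a) u.1) ∂torusMeasure L ∂(μ : Measure (H L)) =
      ∫⁻ u, g u.1 ∂(μ : Measure (H L)) := by
  have hmeas : Measurable fun p : H L × Torus L => g (translate (-p.2) p.1.1) :=
    hg.comp (continuous_uncurry_translate.comp (continuous_snd.neg.prodMk
      (continuous_subtype_val.comp continuous_fst))).measurable
  have hinv (a : Torus L) : ∫⁻ u, g (translate (-a) u.1) ∂(μ : Measure (H L)) =
      ∫⁻ u, g u.1 ∂(μ : Measure (H L)) := ((hμ (-a)).comp hg).lintegral_eq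
  rw [lintegral_lintegral_swap hmeas.aemeasurable]
  simp only [hinv, lintegral_const, measure_univ, mul_one]

theorem IsHomogeneous.lintegral_pointValue_increment (hμ : IsHomogeneous μ) (i : Fin 3) (t : ℝ) :
    ∫⁻ u, ‖pointValue u.1 (Pi.single i (t : AddCircle L)) - pointValue u.1 0‖ₑ ^ 2
        ∂(μ : Measure (H L)) =
      ∑' m, ENNReal.ofReal (2 - 2 * Real.cos (t * wave L m i)) *
        ∫⁻ u, ‖fourierCoef u.1 m‖ₑ ^ 2 ∂(μ : Measure (H L)) := by
  have hpoint : Measurable fun u : L2 L =>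
      ‖pointValue u (Pi.single i (t : AddCircle L)) - pointValue u 0‖ₑ ^ 2 :=
    (((measurable_pointValue _).sub (measurable_pointValue 0)).enorm).pow_const 2
  have hcoef (m : Fin 3 → ℤ) : Measurable fun u : H L => ‖fourierCoef u.1 m‖ₑ ^ 2 :=
    ((measurable_fourierCoef m).comp continuous_subtype_val.measurable).enorm.pow_const 2
  rw [← hμ.lintegral_lintegral_translate hpoint]
  simp only [lintegral_pointValue_translate_increment, lintegral_enorm_increment_sq]
  rw [lintegral_tsum fun m => ((hcoef m).const_mul _).aemeasurable]
  exact tsum_congr fun m => lintegral_const_mul _ (hcoef m)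

end Homogeneous

section Isotropic

theorem integral_comp_of_measurePreserving {α β E : Type*} [MeasurableSpace α] [MeasurableSpace β]
    [NormedAddCommGroup E] [NormedSpace ℝ E] {μ : Measure α} {ν : Measure β} {f : α → β}
    (hf : MeasurePreserving f μ ν) {g : β → E} (hg : AEStronglyMeasurable g ν) :
    ∫ x, g (f x) ∂μ = ∫ y, g y ∂ν := by
  rw [← hf.map_eq] at hg ⊢
  exact (integral_map hf.measurable.aemeasurable hg).symm

theorem character_coe {L : ℝ} (m : Fin 3 → ℤ) (y : Fin 3 → ℝ) :
    character m (fun j => (y j : AddCircle L)) =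
      Complex.exp (2 * Real.pi * Complex.I / L * (((Int.cast ∘ m) ⬝ᵥ y : ℝ) : ℂ)) := by
  simp only [character, fourier_coe_apply, dotProduct, Function.comp_apply]
  push_cast
  rw [Finset.mul_sum, Complex.exp_sum]
  refine Finset.prod_congr rfl fun j _ => ?_
  congr 1
  ring

theorem CoordRotation.transpose_mul (R : CoordRotation) : R.1.transpose * R.1 = 1 :=
  (Matrix.mem_orthogonalGroup_iff' _ _).1 (Matrix.mem_specialOrthogonalGroup_iff.1 R.2).1

theorem CoordRotation.transpose_map_mul_map {S : Type*} [CommRing S] (R : CoordRotation) :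
    (R.1.map (Int.cast : ℤ → S)).transpose * R.1.map (Int.cast : ℤ → S) = 1 := by
  have h := congrArg (Int.castRingHom S).mapMatrix R.transpose_mul
  rwa [map_mul, map_one] at h

theorem torusRotation_coe {L : ℝ} (R : CoordRotation) (y : Fin 3 → ℝ) :
    torusRotation L R (fun j => (y j : AddCircle L)) =
      fun j => ((R.1.map (Int.cast : ℤ → ℝ)).mulVec y j : AddCircle L) := by
  ext j
  simp [torusRotation, Matrix.mulVec, dotProduct, Fin.sum_univ_three, ← zsmul_eq_mul]

theorem character_torusRotation {L : ℝ} (R : CoordRotation) (m : Fin 3 → ℤ) (x : Torus L) :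
    character (R.1.mulVec m) (torusRotation L R x) = character m x := by
  obtain ⟨y, rfl⟩ := exists_coe_torus x
  have hcast : (Int.cast ∘ R.1.mulVec m : Fin 3 → ℝ) =
      (R.1.map (Int.cast : ℤ → ℝ)).mulVec (Int.cast ∘ m) :=
    funext fun j => RingHom.map_mulVec (Int.castRingHom ℝ) R.1 m j
  rw [torusRotation_coe, character_coe, character_coe, hcast, Matrix.dotProduct_mulVec,
    ← Matrix.mulVec_transpose, Matrix.mulVec_mulVec, R.transpose_map_mul_map, Matrix.one_mulVec]

theorem CoordRotation.map_mem_unitaryGroup (R : CoordRotation) :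
    R.1.map (Int.cast : ℤ → ℂ) ∈ Matrix.unitaryGroup (Fin 3) ℂ := by
  have hreal : (R.1.map (Int.cast : ℤ → ℂ)).conjTranspose =
      (R.1.map (Int.cast : ℤ → ℂ)).transpose := by
    ext i j
    simp
  rw [Matrix.mem_unitaryGroup_iff', Matrix.star_eq_conjTranspose, hreal, R.transpose_map_mul_map]

variable {L : ℝ} [Fact (0 < L)]

theorem fourierCoef_rotateArgument (R : CoordRotation) (u : L2 L) (m : Fin 3 → ℤ) :
    fourierCoef (rotateArgument R u) m = fourierCoef u (R.1.mulVec m) := by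
  have hmp := measurePreserving_torusRotation L R
  ext j
  simp only [fourierCoef]
  rw [← integral_comp_of_measurePreserving hmp
    (integrable_character_mul u (R.1.mulVec m) j).aestronglyMeasurable]
  refine integral_congr_ae ?_
  filter_upwards [Lp.coeFn_compMeasurePreserving u hmp] with x hx
  rw [character_torusRotation, rotateArgument, hx, Function.comp_apply]

theorem fourierCoef_rotateValue (R : CoordRotation) (u : L2 L) (m : Fin 3 → ℤ) :
    fourierCoef (rotateValue R u) m =
      Matrix.toEuclideanCLM (n := Fin 3) (𝕜 := ℂ) (R.1.map (Int.cast : ℤ → ℂ))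
        (fourierCoef u m) := by
  ext j
  rw [Matrix.ofLp_toEuclideanCLM]
  simp only [fourierCoef, Matrix.mulVec, dotProduct]
  simp only [← integral_const_mul]
  rw [← integral_finsetSum _ fun l _ => (integrable_character_mul u m l).const_mul _]
  refine integral_congr_ae ?_
  filter_upwards [coeFn_rotateValue R u] with x hx
  rw [hx, Matrix.ofLp_toEuclideanCLM]
  simp only [Matrix.mulVec, dotProduct, Matrix.map_apply]
  push_cast
  rw [Finset.mul_sum]
  exact Finset.sum_congr rfl fun l _ => mul_left_comm _ _ _

theorem norm_fourierCoef_rotateValue (R : CoordRotation) (u : L2 L) (m : Fin 3 → ℤ) :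
    ‖fourierCoef (rotateValue R u) m‖ = ‖fourierCoef u m‖ := by
  rw [fourierCoef_rotateValue]
  exact ContinuousLinearMap.norm_map_of_mem_unitary
    (Unitary.map_mem _ R.map_mem_unitaryGroup) _

theorem IsIsotropic.lintegral_fourierCoef_mulVec {μ : ProbabilityMeasure (H L)}
    (hμ : IsIsotropic μ) (R : CoordRotation) (m : Fin 3 → ℤ) :
    ∫⁻ u, ‖fourierCoef u.1 (R.1.mulVec m)‖ₑ ^ 2 ∂(μ : Measure (H L)) =
      ∫⁻ u, ‖fourierCoef u.1 m‖ₑ ^ 2 ∂(μ : Measure (H L)) := by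
  have h := ((hμ R).comp ((measurable_fourierCoef m).enorm.pow_const 2)).lintegral_eq
  simpa only [Function.comp_def, fourierCoef_rotateArgument, ← ofReal_norm,
    norm_fourierCoef_rotateValue] using h

/-- The rotation by `2π/3` that permutes the coordinates cyclically, `(R x)_j = x_{j+1}`. -/
def cyclicRotation : CoordRotation :=
  ⟨!![0, 1, 0; 0, 0, 1; 1, 0, 0], by
    rw [Matrix.mem_specialOrthogonalGroup_iff, Matrix.mem_orthogonalGroup_iff]
    decide⟩

theorem cyclicRotation_mulVec (m : Fin 3 → ℤ) (j : Fin 3) :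
    cyclicRotation.1.mulVec m j = m (j + 1) := by
  fin_cases j <;> simp [cyclicRotation, Matrix.mulVec, dotProduct, Fin.sum_univ_three]

end Isotropic

/-! ### The weights of the increments -/

section IncrementWeight

theorem two_sub_two_mul_cos_le (x : ℝ) : 2 - 2 * Real.cos x ≤ 4 * min (x ^ 2) 1 := by
  have hsq := Real.one_sub_sq_div_two_le_cos (x := x)
  have hcos := Real.neg_one_le_cos x
  rcases min_choice (x ^ 2) 1 with h | h <;> rw [h]
  · linarith [sq_nonneg x]
  · linarith

theorem sq_div_four_le_two_sub_two_mul_cos {x : ℝ} (hx : |x| ≤ Real.pi) :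
    x ^ 2 / 4 ≤ 2 - 2 * Real.cos x := by
  have hcos := Real.cos_le_one_sub_mul_cos_sq hx
  have hpi : 1 / 16 ≤ 1 / Real.pi ^ 2 :=
    one_div_le_one_div_of_le (by positivity) (by nlinarith [Real.pi_pos, Real.pi_le_four])
  have hmul := mul_le_mul_of_nonneg_right hpi (sq_nonneg x)
  have hdiv : 2 / Real.pi ^ 2 * x ^ 2 = 2 * (1 / Real.pi ^ 2 * x ^ 2) := by ring
  linarith

theorem integral_two_sub_two_mul_cos {x : ℝ} (hx : x ≠ 0) :
    ∫ s in (1 / 8 : ℝ)..1, (2 - 2 * Real.cos (s * x)) =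
      7 / 4 - 2 * (x⁻¹ * (Real.sin x - Real.sin (1 / 8 * x))) := by
  rw [intervalIntegral.integral_sub (by simp) (Continuous.intervalIntegrable (by fun_prop) _ _),
    intervalIntegral.integral_const, intervalIntegral.integral_const_mul,
    intervalIntegral.integral_comp_mul_right _ hx, integral_cos, one_mul, smul_eq_mul, smul_eq_mul]
  norm_num

theorem sq_div_sixteen_le_integral_of_abs_le_pi {x : ℝ} (hx : |x| ≤ Real.pi) :
    x ^ 2 / 16 ≤ ∫ s in (1 / 8 : ℝ)..1, (2 - 2 * Real.cos (s * x)) := by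
  calc x ^ 2 / 16 ≤ ∫ s in (1 / 8 : ℝ)..1, s ^ 2 * (x ^ 2 / 4) := by
        rw [intervalIntegral.integral_mul_const, integral_pow]
        norm_num
        nlinarith [sq_nonneg x]
    _ ≤ _ := by
        refine intervalIntegral.integral_mono_on (by norm_num)
          (Continuous.intervalIntegrable (by fun_prop) _ _)
          (Continuous.intervalIntegrable (by fun_prop) _ _) fun s hs => ?_
        have hs0 : 0 ≤ s := by linarith [hs.1]
        have hsx : |s * x| ≤ Real.pi := by
          rw [abs_mul, abs_of_nonneg hs0]
          exact (mul_le_of_le_one_left (abs_nonneg x) hs.2).trans hx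
        rw [← mul_div_assoc, ← mul_pow]
        exact sq_div_four_le_two_sub_two_mul_cos hsx

theorem one_div_sixteen_le_integral_of_pi_lt_abs {x : ℝ} (hx : Real.pi < |x|) :
    1 / 16 ≤ ∫ s in (1 / 8 : ℝ)..1, (2 - 2 * Real.cos (s * x)) := by
  have hx3 : 3 < |x| := Real.pi_gt_three.trans hx
  have hsin : |Real.sin x - Real.sin (1 / 8 * x)| ≤ 2 :=
    (abs_sub _ _).trans (by
      linarith [Real.abs_sin_le_one x, Real.abs_sin_le_one (1 / 8 * x)])
  have hbound : |x⁻¹ * (Real.sin x - Real.sin (1 / 8 * x))| ≤ 1 / 3 * 2 := by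
    rw [abs_mul, abs_inv, ← one_div]
    gcongr
  rw [integral_two_sub_two_mul_cos (abs_pos.1 (by linarith))]
  linarith [le_of_abs_le hbound]

/-- The weight `2 - 2 cos (s x)` vanishes at every multiple of `2π`; its average over `s` does
not. -/
theorem min_sq_one_le_integral (x : ℝ) :
    min (x ^ 2) 1 ≤ 16 * ∫ s in (1 / 8 : ℝ)..1, (2 - 2 * Real.cos (s * x)) := by
  rcases le_or_gt |x| Real.pi with h | h
  · linarith [min_le_left (x ^ 2) 1, sq_div_sixteen_le_integral_of_abs_le_pi h]
  · linarith [min_le_right (x ^ 2) 1, one_div_sixteen_le_integral_of_pi_lt_abs h]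

theorem min_ofReal_sq_one_le_lintegral (x : ℝ) :
    min (ENNReal.ofReal (x ^ 2)) 1 ≤
      16 * ∫⁻ s in Set.Ioc (1 / 8 : ℝ) 1, ENNReal.ofReal (2 - 2 * Real.cos (s * x)) := by
  have hint : IntegrableOn (fun s : ℝ => 2 - 2 * Real.cos (s * x)) (Set.Ioc (1 / 8) 1) :=
    (Continuous.integrableOn_Icc (by fun_prop)).mono_set Set.Ioc_subset_Icc_self
  have hnonneg (s : ℝ) : 0 ≤ 2 - 2 * Real.cos (s * x) := by linarith [Real.cos_le_one (s * x)]
  have h := ENNReal.ofReal_le_ofReal (min_sq_one_le_integral x)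
  rw [ENNReal.ofReal_mul (by norm_num), intervalIntegral.integral_of_le (by norm_num),
    ofReal_integral_eq_lintegral_ofReal hint (ae_of_all _ hnonneg), ENNReal.ofReal_min] at h
  simpa using h

end IncrementWeight

/-! ### Comparison of the increments with the spectral sum -/

/-- The mean square of `u(x + t e_i) - u(x)`, averaged over `x`, as a weighted sum of the mode
energies; for a homogeneous law it is the mean square of `u(t e_i) - u(0)`. -/
def spectralIncrement (τ : Triple) (i : Fin 3) (t : ℝ) : ℝ≥0∞ :=
  ∑' m, ENNReal.ofReal (2 - 2 * Real.cos (t * wave τ.L m i)) * modeEnergy τ m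

theorem meanSquareIncrement_eq_spectralIncrement {τ : Triple} (hτ : IsHomogeneous τ.μ)
    (i : Fin 3) : meanSquareIncrement i τ = spectralIncrement τ i 1 :=
  hτ.lintegral_pointValue_increment i 1

theorem spectralIncrement_add_one {τ : Triple} (hτ : IsIsotropic τ.μ) (i : Fin 3) (t : ℝ) :
    spectralIncrement τ (i + 1) t = spectralIncrement τ i t := by
  let shift : (Fin 3 → ℤ) ≃ (Fin 3 → ℤ) :=
    (Equiv.addRight (1 : Fin 3)).symm.arrowCongr (Equiv.refl ℤ)
  have hshift (m : Fin 3 → ℤ) : shift m = cyclicRotation.1.mulVec m :=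
    funext fun j => (cyclicRotation_mulVec m j).symm
  have henergy (m : Fin 3 → ℤ) : modeEnergy τ (shift m) = modeEnergy τ m := by
    rw [hshift]
    exact hτ.lintegral_fourierCoef_mulVec cyclicRotation m
  refine Eq.trans (tsum_congr fun m => ?_) (shift.tsum_eq _)
  rw [henergy]
  rfl

theorem spectralIncrement_eq {τ : Triple} (hτ : IsIsotropic τ.μ) (i j : Fin 3) (t : ℝ) :
    spectralIncrement τ i t = spectralIncrement τ j t := by
  have h₁ : spectralIncrement τ 1 t = spectralIncrement τ 0 t := spectralIncrement_add_one hτ 0 t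
  have h₂ : spectralIncrement τ 2 t = spectralIncrement τ 1 t := spectralIncrement_add_one hτ 1 t
  fin_cases i <;> fin_cases j <;> simp [h₁, h₂]

theorem lowHighSum_eq_tsum_min (τ : Triple) :
    lowHighSum τ = ∑' m, min (‖wave τ.L m‖ₑ ^ 2) 1 * modeEnergy τ m := by
  have hlow := tsum_subtype {m | m ≠ 0 ∧ ‖wave τ.L m‖ ≤ 1}
    fun m => ‖wave τ.L m‖ₑ ^ 2 * modeEnergy τ m
  have hhigh := tsum_subtype {m | m ≠ 0 ∧ 1 < ‖wave τ.L m‖} fun m => modeEnergy τ m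
  refine (congrArg₂ (· + ·) hlow hhigh).trans ?_
  rw [← ENNReal.tsum_add]
  refine tsum_congr fun m => ?_
  rcases eq_or_ne m 0 with rfl | hm
  · have hwave : wave τ.L 0 = 0 := by
      ext j
      simp [wave]
    simp [hwave]
  rcases le_or_gt ‖wave τ.L m‖ 1 with h | h
  · have hsq : ‖wave τ.L m‖ₑ ^ 2 ≤ 1 := by
      rw [enorm_pow_eq_ofReal, ENNReal.ofReal_le_one]
      exact pow_le_one₀ (norm_nonneg _) h
    simp [Set.indicator, hm, h, h.not_gt, min_eq_left hsq]
  · have hsq : 1 ≤ ‖wave τ.L m‖ₑ ^ 2 := by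
      rw [enorm_pow_eq_ofReal, ENNReal.one_le_ofReal]
      exact one_le_pow₀ h.le
    simp [Set.indicator, hm, h, h.not_ge, min_eq_right hsq]

theorem enorm_sq_eq_sum_ofReal_sq {ι : Type*} [Fintype ι] (v : EuclideanSpace ℝ ι) :
    ‖v‖ₑ ^ 2 = ∑ j, ENNReal.ofReal (v j ^ 2) := by
  rw [enorm_sq_eq_sum]
  simp only [enorm_pow_eq_ofReal, Real.norm_eq_abs, sq_abs]

theorem min_sum_one_le_sum_min {ι : Type*} (s : Finset ι) (f : ι → ℝ≥0∞) :
    min (∑ j ∈ s, f j) 1 ≤ ∑ j ∈ s, min (f j) 1 := by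
  refine Finset.le_sum_of_subadditive (fun x => min x 1) (by simp) (fun a b => ?_) s f
  rcases le_total 1 a with ha | ha
  · exact (min_le_right _ _).trans (by simp [ha])
  rcases le_total 1 b with hb | hb
  · exact (min_le_right _ _).trans (by simp [hb])
  · simp [ha, hb]

theorem ofReal_two_sub_two_mul_cos_le_min (v : EuclideanSpace ℝ (Fin 3)) (i : Fin 3) :
    ENNReal.ofReal (2 - 2 * Real.cos (v i)) ≤ 4 * min (‖v‖ₑ ^ 2) 1 := by
  calc ENNReal.ofReal (2 - 2 * Real.cos (v i)) ≤ ENNReal.ofReal (4 * min (v i ^ 2) 1) :=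
        ENNReal.ofReal_le_ofReal (two_sub_two_mul_cos_le (v i))
    _ = 4 * min (ENNReal.ofReal (v i ^ 2)) 1 := by
        rw [ENNReal.ofReal_mul (by norm_num), ENNReal.ofReal_min]
        simp
    _ ≤ 4 * min (‖v‖ₑ ^ 2) 1 := by
        rw [enorm_sq_eq_sum_ofReal_sq]
        gcongr
        exact Finset.single_le_sum (f := fun j => ENNReal.ofReal (v j ^ 2))
          (fun _ _ => zero_le) (Finset.mem_univ i)

theorem spectralIncrement_one_le_lowHighSum (τ : Triple) (i : Fin 3) :
    spectralIncrement τ i 1 ≤ 4 * lowHighSum τ := by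
  rw [lowHighSum_eq_tsum_min, ← ENNReal.tsum_mul_left, spectralIncrement]
  refine ENNReal.tsum_le_tsum fun m => ?_
  rw [one_mul, ← mul_assoc]
  gcongr
  exact ofReal_two_sub_two_mul_cos_le_min (wave τ.L m) i

theorem min_enorm_sq_one_le_lintegral {ι : Type*} [Fintype ι] (v : EuclideanSpace ℝ ι) :
    min (‖v‖ₑ ^ 2) 1 ≤
      16 * ∑ j, ∫⁻ s in Set.Ioc (1 / 8 : ℝ) 1, ENNReal.ofReal (2 - 2 * Real.cos (s * v j)) := by
  rw [enorm_sq_eq_sum_ofReal_sq, Finset.mul_sum]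
  exact (min_sum_one_le_sum_min _ _).trans
    (Finset.sum_le_sum fun j _ => min_ofReal_sq_one_le_lintegral (v j))

theorem lowHighSum_le_lintegral_spectralIncrement (τ : Triple) :
    lowHighSum τ ≤ 16 * ∑ j, ∫⁻ s in Set.Ioc (1 / 8 : ℝ) 1, spectralIncrement τ j s := by
  have hmeas (m : Fin 3 → ℤ) (j : Fin 3) :
      Measurable fun s : ℝ => ENNReal.ofReal (2 - 2 * Real.cos (s * wave τ.L m j)) := by
    fun_prop
  have hsum (j : Fin 3) : ∫⁻ s in Set.Ioc (1 / 8 : ℝ) 1, spectralIncrement τ j s =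
      ∑' m, (∫⁻ s in Set.Ioc (1 / 8 : ℝ) 1,
        ENNReal.ofReal (2 - 2 * Real.cos (s * wave τ.L m j))) * modeEnergy τ m := by
    simp only [spectralIncrement]
    rw [lintegral_tsum fun m => ((hmeas m j).mul_const _).aemeasurable]
    exact tsum_congr fun m => lintegral_mul_const _ (hmeas m j)
  simp only [hsum]
  rw [lowHighSum_eq_tsum_min, ← Summable.tsum_finsetSum fun _ _ => ENNReal.summable,
    ← ENNReal.tsum_mul_left]
  refine ENNReal.tsum_le_tsum fun m => ?_
  rw [← Finset.sum_mul, ← mul_assoc]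
  gcongr
  exact min_enorm_sq_one_le_lintegral (wave τ.L m)

theorem lowHighSum_le_of_spectralIncrement_le {τ : Triple} (hτ : IsIsotropic τ.μ) {i : Fin 3}
    {C : ℝ≥0∞} (h : ∀ s ∈ Set.Icc (1 / 8 : ℝ) 1, spectralIncrement τ i s ≤ C) :
    lowHighSum τ ≤ 48 * C := by
  have hint (j : Fin 3) : ∫⁻ s in Set.Ioc (1 / 8 : ℝ) 1, spectralIncrement τ j s ≤ C :=
    calc ∫⁻ s in Set.Ioc (1 / 8 : ℝ) 1, spectralIncrement τ j s
        ≤ ∫⁻ _ in Set.Ioc (1 / 8 : ℝ) 1, C := setLIntegral_mono measurable_const fun s hs =>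
          (spectralIncrement_eq hτ j i s).trans_le (h s (Set.Ioc_subset_Icc_self hs))
      _ ≤ C := by
          rw [setLIntegral_const, Real.volume_Ioc]
          exact mul_le_of_le_one_right zero_le (by simp)
  calc lowHighSum τ ≤ 16 * ∑ j, ∫⁻ s in Set.Ioc (1 / 8 : ℝ) 1, spectralIncrement τ j s :=
        lowHighSum_le_lintegral_spectralIncrement τ
    _ ≤ 16 * ∑ _j : Fin 3, C := by
        gcongr with j
        exact hint j
    _ = 48 * C := by
        rw [Finset.sum_const, Finset.card_fin, nsmul_eq_mul, ← mul_assoc]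
        norm_num

/-! ### Scale invariant families -/

/-- The image `(μ', ν l⁻⁴, L l⁻³)` of a triple under the rescaling `u ↦ l⁻¹ u(l³ ·)`. With time
rescaled by `l²`, these exponents preserve the Navier–Stokes equations together with the noise. -/
def Triple.rescale (τ : Triple) {l : ℝ≥0} (hl : 0 < l) : Triple :=
  have hL : Fact (0 < τ.L / (l : ℝ) ^ 3) := ⟨div_pos τ.L_pos.out (by positivity)⟩
  { ν := τ.ν / (l : ℝ) ^ 4
    ν_pos := div_pos τ.ν_pos (by positivity)
    L := τ.L / (l : ℝ) ^ 3
    L_pos := hL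
    μ := rescaleLaw τ.L (τ.L / (l : ℝ) ^ 3) (l⁻¹ : ℝ) τ.μ }

theorem Triple.rescale_L_inv_mul (τ : Triple) {l : ℝ≥0} (hl : 0 < l) :
    (τ.rescale hl).L⁻¹ * τ.L = l ^ 3 := by
  have hL := τ.L_pos.out.ne'
  have hl₀ : (l : ℝ) ≠ 0 := by exact_mod_cast hl.ne'
  simp only [Triple.rescale]
  field_simp

theorem modeEnergy_rescale (τ : Triple) {l : ℝ≥0} (hl : 0 < l) (m : Fin 3 → ℤ) :
    modeEnergy (τ.rescale hl) m = ‖(l⁻¹ : ℝ)‖ₑ ^ 2 * modeEnergy τ m := by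
  have hmeas : Measurable fun u : H (τ.rescale hl).L => ‖fourierCoef u.1 m‖ₑ ^ 2 :=
    ((measurable_fourierCoef m).comp continuous_subtype_val.measurable).enorm.pow_const 2
  have hlaw : ((τ.rescale hl).μ : Measure (H (τ.rescale hl).L)) =
      (τ.μ : Measure (H τ.L)).map (NSK41.rescale τ.L (τ.rescale hl).L (l⁻¹ : ℝ)) :=
    coe_rescaleLaw (L' := (τ.rescale hl).L) _ _
  rw [modeEnergy, hlaw, lintegral_map hmeas (continuous_rescale _).measurable]
  simp only [enorm_fourierCoef_rescale, mul_pow]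
  exact lintegral_const_mul' _ _ (ENNReal.pow_ne_top enorm_ne_top)

theorem spectralIncrement_rescale (τ : Triple) {l : ℝ≥0} (hl : 0 < l) (i : Fin 3) (t : ℝ) :
    spectralIncrement (τ.rescale hl) i t =
      ‖(l⁻¹ : ℝ)‖ₑ ^ 2 * spectralIncrement τ i (t * l ^ 3) := by
  rw [spectralIncrement, spectralIncrement, ← ENNReal.tsum_mul_left]
  refine tsum_congr fun m => ?_
  rw [modeEnergy_rescale, wave_eq_smul τ.L_pos.out.ne', τ.rescale_L_inv_mul hl, PiLp.smul_apply,
    smul_eq_mul, ← mul_assoc t]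
  ring

theorem spectralIncrement_pow_le_rescale (τ : Triple) {l : ℝ≥0} (hl : 0 < l) (hl₁ : l ≤ 1)
    (i : Fin 3) : spectralIncrement τ i (l ^ 3) ≤ spectralIncrement (τ.rescale hl) i 1 := by
  rw [spectralIncrement_rescale, one_mul]
  refine le_mul_of_one_le_left zero_le (one_le_pow₀ ?_)
  rw [← NNReal.coe_inv, ← ofReal_norm, ENNReal.one_le_ofReal, NNReal.norm_eq]
  exact_mod_cast (one_le_inv₀ hl).2 hl₁

/-- Families of triples that are stable under `Triple.rescale`. -/
def IsScaleInvariant (M : Set Triple) : Prop :=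
  ∀ τ ∈ M, ∀ ⦃l : ℝ≥0⦄ (hl : 0 < l), τ.rescale hl ∈ M

theorem isScaleInvariant_rescaledNS (σ : NoiseCoefficients) : IsScaleInvariant (rescaledNS σ) :=
  fun τ hτ _ hl => rescaleLaw_mem_stationaryNS (L' := (τ.rescale hl).L) hτ hl
    (τ.rescale_L_inv_mul hl) (div_mul_cancel₀ _ (pow_ne_zero 4 (by exact_mod_cast hl.ne')))

theorem IsAdmissible.exists_forall_rescale_mem {D : Set (ℝ × ℝ)} (hD : IsAdmissible D) :
    ∃ D' ⊆ D, IsAdmissible D' ∧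
      ∀ p ∈ D', ∀ l ∈ Set.Icc (1 / 2 : ℝ) 1, (p.1 / l ^ 4, p.2 / l ^ 3) ∈ D := by
  obtain ⟨ν₀, R₀, hν₀, hR₁, hanti, hlim, rfl⟩ := hD
  have hsub : Set.Ioc 0 (ν₀ / 16) ⊆ Set.Ioc 0 ν₀ := Set.Ioc_subset_Ioc_right (by linarith)
  refine ⟨{p | 0 < p.1 ∧ p.1 < ν₀ / 16 ∧ R₀ p.1 < p.2},
    fun p ⟨hν, hν', hR⟩ => ⟨hν, by linarith, hR⟩,
    ⟨ν₀ / 16, R₀, by linarith, fun ν hν => hR₁ ν (hsub hν), hanti.mono hsub, hlim, rfl⟩, ?_⟩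
  rintro ⟨ν, L⟩ ⟨hν, hν', hR⟩ l ⟨hl, hl₁⟩
  dsimp only at hν hν' hR ⊢
  have hl₀ : 0 < l := by linarith
  have hl₄ : 1 / 16 ≤ l ^ 4 := by
    calc (1 / 16 : ℝ) = (1 / 2) ^ 4 := by norm_num
      _ ≤ l ^ 4 := by gcongr
  have hν_mem : ν ∈ Set.Ioc 0 ν₀ := ⟨hν, by linarith⟩
  have hν_le : ν ≤ ν / l ^ 4 := le_div_self hν.le (by positivity) (pow_le_one₀ hl₀.le hl₁)
  have hν_lt : ν / l ^ 4 < ν₀ := by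
    rw [div_lt_iff₀ (by positivity)]
    nlinarith
  have hL_le : L ≤ L / l ^ 3 :=
    le_div_self (by linarith [hR₁ ν hν_mem]) (by positivity) (pow_le_one₀ hl₀.le hl₁)
  refine ⟨by positivity, hν_lt, ?_⟩
  calc R₀ (ν / l ^ 4) ≤ R₀ ν := hanti.antitoneOn hν_mem ⟨by positivity, hν_lt.le⟩ hν_le
    _ < L := hR
    _ ≤ L / l ^ 3 := hL_le

theorem exists_cube_eq {s : ℝ} (hs : s ∈ Set.Icc (1 / 8 : ℝ) 1) :
    ∃ l : ℝ≥0, (l : ℝ) ∈ Set.Icc (1 / 2 : ℝ) 1 ∧ (l : ℝ) ^ 3 = s := by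
  have hmem : s ∈ (fun l : ℝ => l ^ 3) '' Set.Icc (1 / 2) 1 :=
    intermediate_value_Icc (by norm_num) (by fun_prop) (by norm_num at hs ⊢; exact hs)
  obtain ⟨l, hl, rfl⟩ := hmem
  exact ⟨⟨l, by linarith [hl.1]⟩, hl, rfl⟩

end

end NSK41

theorem mainTheorem8_general {M : Set NSK41.Triple} (i : Fin 3)
    (hhom : ∀ τ ∈ M, NSK41.IsHomogeneous τ.μ) (hiso : ∀ τ ∈ M, NSK41.IsIsotropic τ.μ)
    (hscale : NSK41.IsScaleInvariant M) (hA : NSK41.ConditionA i M) : NSK41.ConditionB M := by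
  obtain ⟨D, hD, c, C, hc, hcC, hM⟩ := hA
  obtain ⟨D', hD'D, hD', hD'_rescale⟩ := hD.exists_forall_rescale_mem
  refine ⟨D', hD', c / 4, 48 * C, by linarith, by linarith, fun τ hτ hτD' => ⟨?_, ?_⟩⟩
  · have hlower : ENNReal.ofReal c ≤ 4 * NSK41.lowHighSum τ :=
      calc ENNReal.ofReal c ≤ NSK41.meanSquareIncrement i τ := (hM τ hτ (hD'D hτD')).1
        _ = NSK41.spectralIncrement τ i 1 :=
          NSK41.meanSquareIncrement_eq_spectralIncrement (hhom τ hτ) i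
        _ ≤ 4 * NSK41.lowHighSum τ := NSK41.spectralIncrement_one_le_lowHighSum τ i
    rw [ENNReal.ofReal_div_of_pos (by norm_num)]
    exact ENNReal.div_le_of_le_mul' (by simpa using hlower)
  · rw [ENNReal.ofReal_mul (by norm_num), ENNReal.ofReal_ofNat]
    refine NSK41.lowHighSum_le_of_spectralIncrement_le (hiso τ hτ) (i := i) fun s hs => ?_
    obtain ⟨l, hl, rfl⟩ := NSK41.exists_cube_eq hs
    have hl₀ : 0 < l := NNReal.coe_pos.1 (by linarith [hl.1])
    have hτl := hscale τ hτ hl₀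
    calc NSK41.spectralIncrement τ i (l ^ 3) ≤ NSK41.spectralIncrement (τ.rescale hl₀) i 1 :=
          NSK41.spectralIncrement_pow_le_rescale τ hl₀ (by exact_mod_cast hl.2) i
      _ = NSK41.meanSquareIncrement i (τ.rescale hl₀) :=
          (NSK41.meanSquareIncrement_eq_spectralIncrement (hhom _ hτl) i).symm
      _ ≤ ENNReal.ofReal C := (hM _ hτl (hD'_rescale _ hτD' _ hl)).2

theorem mainTheorem8 (σ : NSK41.NoiseCoefficients) (i : Fin 3)
    (hA : NSK41.ConditionA i (NSK41.rescaledNS σ)) :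
    NSK41.ConditionB (NSK41.rescaledNS σ) :=
  mainTheorem8_general i (fun _ => NSK41.isHomogeneous_of_mem_stationaryNS)
    (fun _ => NSK41.isIsotropic_of_mem_stationaryNS) (NSK41.isScaleInvariant_rescaledNS σ) hA
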